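/- All graphs are finite and simple. A graph $G$ is $3$-connected if $|V(G)|\ge 3$ and $G\setminus X$ is connected for every $X\subseteq V(G)$ with $|X|<3$. A branch-decomposition of a finite set $X$ is a tree $T$ all of whose vertices have degree $1$ or $3$, together with a bijection from the leaves of $T$ to $X$; each edge of $T$ thereby induces a partition of $X$ into two parts. For $A\subseteq V(G)$ let $\operatorname{mm}_G(A)$ be the maximum size of a matching in the bipartite graph formed by the edges of $G$ between $A$ and $V(G)\setminus A$. The maximum matching width $\operatorname{mmw}(G)$ is the minimum, over all branch-decompositions of $V(G)$, of the maximum of $\operatorname{mm}_G(A)$ over the partitions $(A,V(G)\setminus A)$ induced by the edges of the tree (and $0$ if $|V(G)|\le 1$). A minor of $G$ is a graph obtained, up to isomorphism, by deleting edges, deleting vertices and contracting edges (loops and parallel edges being removed); it is proper if it is not isomorphic to $G$. A graph is minor-minimal with respect to a property if it has the property and no proper minor of it has the property. Let $\mathcal{O}_3$ be the set consisting of the following five graphs on the vertex set $\{0,1,\dots,6\}$: the wheel with hub $6$ and rim the $6$-cycle $0\,1\,2\,3\,4\,5$; the complete bipartite graph $K_{4,3}$ with parts $\{0,1,2,3\}$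 and $\{4,5,6\}$; and the three graphs in which $6$ is adjacent exactly to $2,3,4,5$ and the remaining edges form three internally disjoint paths from $0$ to $1$, namely * $0\,2\,1$, $\;0\,3\,1$, $\;0\,4\,5\,1$; * $0\,1$, $\;0\,2\,1$, $\;0\,3\,4\,5\,1$; * $0\,1$, $\;0\,2\,3\,1$, $\;0\,4\,5\,1$. These five graphs are pairwise non-isomorphic and are, up to isomorphism, precisely the edge-minimal $3$-connected graphs on $7$ vertices, that is, the $3$-connected graphs on $7$ vertices that have no $3$-connected proper spanning subgraph. A $3$-connected graph $G$ is minor-minimal with respect to $\operatorname{mmw}(G)\ge 3$ if and only if it is isomorphic to a graph in $\mathcal{O}_3$. -/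

import Mathlib

namespace MMWidth

universe u

/-- `G` is `k`-connected: it has at least `k` vertices, and deleting fewer than `k` vertices
always leaves a connected graph. -/
def IsKConnected {V : Type u} (k : ℕ) (G : SimpleGraph V) : Prop :=
  k ≤ Nat.card V ∧ ∀ X : Finset V, X.card < k → (G.induce ((X : Set V)ᶜ)).Connected

/-- The leaves of a graph: the vertices of degree `1`. -/
def leaves {N : Type*} (T : SimpleGraph N) : Set N :=
  {t | (T.neighborSet t).ncard = 1}

/-- A branch-decomposition of `X`: a finite tree all of whose vertices have degree `1` or `3`,
with a bijection from its leaves to `X`. -/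
structure BranchDecomposition (X : Type u) where
  Node : Type
  finite_node : Finite Node
  tree : SimpleGraph Node
  isTree : tree.IsTree
  subcubic : ∀ t, (tree.neighborSet t).ncard = 1 ∨ (tree.neighborSet t).ncard = 3
  label : leaves tree ≃ X

/-- The part of `X` on the side of `a` in the partition induced by the edge `ab` of the tree:
the labels of the leaves that are joined to `a` after deleting the edge `ab`. -/
def BranchDecomposition.side {X : Type u} (D : BranchDecomposition X) (a b : D.Node) : Set X :=
  {x | (D.tree.deleteEdges {s(a, b)}).Reachable a (D.label.symm x)}

/-- The `f`-width of a branch-decomposition: the maximum of the values of `f` on the parts of the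
partitions induced by the edges of the tree. (A dart is an edge with an orientation; `f` is meant
to be symmetric, so the orientation is irrelevant. There are finitely many darts.) -/
noncomputable def BranchDecomposition.width {X : Type u} (f : Set X → ℕ)
    (D : BranchDecomposition X) : ℕ :=
  ⨆ d : D.tree.Dart, f (D.side d.fst d.snd)

/-- The `f`-width of `X`: the minimum `f`-width of a branch-decomposition of `X`.
If `X` has at most one element it has no branch-decomposition, and the value is `0`. -/
noncomputable def fWidth {X : Type u} (f : Set X → ℕ) : ℕ :=
  sInf {w | ∃ D : BranchDecomposition X, D.width f = w}

/-- The maximum number of edges of a matching in the bipartite graph formed by the edges of `G`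
between `A` and its complement. -/
noncomputable def mm {V : Type u} (G : SimpleGraph V) (A : Set V) : ℕ :=
  sSup {m | ∃ M : (G.between A Aᶜ).Subgraph, M.IsMatching ∧ M.edgeSet.ncard = m}

/-- The maximum matching width of `G`. -/
noncomputable def mmw {V : Type u} (G : SimpleGraph V) : ℕ :=
  fWidth (mm G)

/-- Contraction of the edge `uv`, keeping the graph simple: `v` is removed and `u`, which stands
for the merged vertex, becomes adjacent to all neighbours of `v` other than `u` itself. -/
def contractEdge {V : Type u} (G : SimpleGraph V) (u v : V) : SimpleGraph {x : V // x ≠ v} :=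
  SimpleGraph.fromRel fun x y => G.Adj x y ∨ ((x : V) = u ∧ G.Adj v y)

/-- `IsMinor G H`: the graph `H` is, up to isomorphism, obtained from `G` by deleting edges,
deleting vertices and contracting edges. -/
inductive IsMinor {V : Type u} (G : SimpleGraph V) : ∀ {W : Type u}, SimpleGraph W → Prop
  | iso {W : Type u} {H : SimpleGraph W} (e : G ≃g H) : IsMinor G H
  | deleteEdge {W W' : Type u} {H : SimpleGraph W} {K : SimpleGraph W'} (h : IsMinor G H)
      (x y : W) (hxy : H.Adj x y) (e : H.deleteEdges {s(x, y)} ≃g K) : IsMinor G K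
  | deleteVertex {W W' : Type u} {H : SimpleGraph W} {K : SimpleGraph W'} (h : IsMinor G H)
      (x : W) (e : H.induce {x}ᶜ ≃g K) : IsMinor G K
  | contract {W W' : Type u} {H : SimpleGraph W} {K : SimpleGraph W'} (h : IsMinor G H)
      (x y : W) (hxy : H.Adj x y) (e : contractEdge H x y ≃g K) : IsMinor G K

/-- `IsProperMinor G H`: `H` is a minor of `G` that is not isomorphic to `G`. -/
def IsProperMinor {V W : Type u} (G : SimpleGraph V) (H : SimpleGraph W) : Prop :=
  IsMinor G H ∧ ¬ Nonempty (G ≃g H)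

/-- `G` has the property `P` but no proper minor of `G` has it. -/
def IsMinorMinimal (P : ∀ W : Type u, SimpleGraph W → Prop) {V : Type u}
    (G : SimpleGraph V) : Prop :=
  P V G ∧ ∀ (W : Type u) (H : SimpleGraph W), IsProperMinor G H → ¬ P W H

/-- The edges of the five graphs, on the vertices `0, …, 6`:
the wheel with six spokes and hub `6`; the complete bipartite graph with parts `{0, 1, 2, 3}` and
`{4, 5, 6}`; and three graphs in which `6` is adjacent to `2, 3, 4, 5` and the other edges form
three internally disjoint paths from `0` to `1`, of lengths `2, 2, 3`, `1, 2, 4` and `1, 3, 3`. -/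
def obstructionEdges : Fin 5 → List (Fin 7 × Fin 7) :=
  ![[(0, 1), (1, 2), (2, 3), (3, 4), (4, 5), (5, 0),
      (6, 0), (6, 1), (6, 2), (6, 3), (6, 4), (6, 5)],
    [(0, 4), (0, 5), (0, 6), (1, 4), (1, 5), (1, 6),
      (2, 4), (2, 5), (2, 6), (3, 4), (3, 5), (3, 6)],
    [(0, 2), (2, 1), (0, 3), (3, 1), (0, 4), (4, 5), (5, 1), (6, 2), (6, 3), (6, 4), (6, 5)],
    [(0, 1), (0, 2), (2, 1), (0, 3), (3, 4), (4, 5), (5, 1), (6, 2), (6, 3), (6, 4), (6, 5)],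
    [(0, 1), (0, 2), (2, 3), (3, 1), (0, 4), (4, 5), (5, 1), (6, 2), (6, 3), (6, 4), (6, 5)]]

/-- The five graphs. -/
def obstruction (i : Fin 5) : SimpleGraph (Fin 7) :=
  SimpleGraph.fromRel fun a b => (a, b) ∈ obstructionEdges i

/-- `G` is, up to isomorphism, one of the five graphs. -/
def InO3 {V : Type u} (G : SimpleGraph V) : Prop :=
  ∃ i, Nonempty (G ≃g obstruction i)

/-- `G` is an edge-minimal `3`-connected graph: it is `3`-connected, and no graph obtained from it
by deleting a non-empty set of edges is. -/
def IsEdgeMinimal3Connected {V : Type u} (G : SimpleGraph V) : Prop :=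
  Minimal (fun H : SimpleGraph V => IsKConnected 3 H) G

end MMWidth

namespace MMWidth

universe u

/-! Everything is decided at seven vertices. A cubic tree with at least seven leaves has an edge
with at least three leaves on either side (`BranchDecomposition.exists_balanced`), and by Hall's
theorem a 3-connected graph has a matching of size three across such a partition
(`IsKConnected.le_mm`); so 3-connected graphs on seven vertices have width at least 3. In the other
direction, explicit decompositions give width at most 2 for at most six vertices, and for seven
vertices one of which has degree at most 2 (`mmw_le_two_of_card_le_six`,
`mmw_le_two_of_degree_le_two`).

Hence a 3-connected minor-minimal graph has at least seven vertices, and exactly seven because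
contractible edges (`exists_contractible_edge`) lead down to a 3-connected minor of that order; it
is then edge-minimal. Conversely, every edge of the five graphs has an end of degree at most 3.
Deleting an edge thus leaves a vertex of degree at most 2, and deleting a vertex or contracting
leaves at most six vertices, so all proper minors have width at most 2.

It remains to find one of the five as a spanning subgraph of any 3-connected graph on seven vertices
(`exists_equiv_obstruction`). Undoing a contraction splits a vertex. Starting from the complete
graph on four vertices, all splits with both new ends of degree at least 3 are enumerated, and
evaluation confirms that each contains a graph of the next list: the 4-wheel; then the prism, the
utility graph and the 5-wheel; then the five (`exists_contains_succ`). Triangle counts tell the five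
apart. -/

/-! ### Connectivity in terms of vertex cuts -/

/-- `X` separates the nonempty set `C` from the nonempty rest of the graph. -/
def IsCut {V : Type*} (G : SimpleGraph V) (X C : Set V) : Prop :=
  C.Nonempty ∧ Disjoint C X ∧ (C ∪ X)ᶜ.Nonempty ∧ ∀ a ∈ C, ∀ b, G.Adj a b → b ∈ C ∪ X

/-- Cuts are easier to transfer between graphs than connectedness of induced subgraphs. If deleting
`X` disconnects the graph, the component of one vertex serves as `C`. -/
theorem isKConnected_iff {V : Type*} [Finite V] {k : ℕ} {G : SimpleGraph V} :
    IsKConnected k G ↔ k ≤ Nat.card V ∧ ∀ X C : Set V, X.ncard < k → ¬ IsCut G X C := by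
  classical
  refine and_congr_right fun hk => ⟨fun h X C hX hC => ?_, fun h X hX => ?_⟩
  · obtain ⟨⟨a, ha⟩, hd, ⟨b, hb⟩, hcl⟩ := hC
    have hfin := X.toFinite
    have hc := h hfin.toFinset (by rwa [← Set.ncard_eq_toFinset_card X])
    rw [Set.Finite.coe_toFinset] at hc
    have haX : a ∈ Xᶜ := fun h' => Set.disjoint_left.1 hd ha h'
    have hbX : b ∈ Xᶜ := fun h' => hb (Or.inr h')
    obtain ⟨p⟩ := hc.preconnected ⟨a, haX⟩ ⟨b, hbX⟩
    have key : ∀ (x y : (Xᶜ : Set V)), (G.induce Xᶜ).Walk x y → (x : V) ∈ C → (y : V) ∈ C := by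
      intro x y q
      induction q with
      | nil => exact id
      | @cons _ s _ hxy _ ih =>
        intro hx
        exact ih ((hcl _ hx _ hxy).resolve_right s.2)
    exact hb (Or.inl (key _ _ p ha))
  · have hne : ((X : Set V)ᶜ).Nonempty := by
      rw [Set.nonempty_compl]
      intro hu
      have := Set.ncard_univ V
      rw [← hu, Set.ncard_coe_finset] at this
      omega
    have : Nonempty ((X : Set V)ᶜ : Set V) := hne.to_subtype
    refine ⟨fun a b => ?_⟩
    by_contra hab
    refine h X {x | ∃ hx : x ∈ (X : Set V)ᶜ, (G.induce (X : Set V)ᶜ).Reachable a ⟨x, hx⟩}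
      (by rwa [Set.ncard_coe_finset]) ⟨⟨a, a.2, .rfl⟩, ?_, ⟨b, ?_⟩, ?_⟩
    · rw [Set.disjoint_left]
      rintro x ⟨hx, -⟩
      exact hx
    · rintro (⟨_, hb⟩ | hb)
      · exact hab hb
      · exact b.2 hb
    · rintro x ⟨hx, hr⟩ y hxy
      by_cases hy : y ∈ (X : Set V)
      · exact Or.inr hy
      · exact Or.inl ⟨hy, hr.trans (SimpleGraph.Adj.reachable (G := G.induce (X : Set V)ᶜ) hxy)⟩

theorem IsKConnected.not_isCut {V : Type*} [Finite V] {k : ℕ} {G : SimpleGraph V}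
    (h : IsKConnected k G) {X C : Set V} (hX : X.ncard < k) : ¬ IsCut G X C :=
  (isKConnected_iff.1 h).2 X C hX

/-- Otherwise the neighbours of `v` cut `v` off; `k < Nat.card V` guarantees a vertex beyond them.
-/
theorem IsKConnected.le_degree {V : Type*} [Finite V] {k : ℕ} {G : SimpleGraph V}
    (h : IsKConnected k G) (hk : k < Nat.card V) (v : V) : k ≤ (G.neighborSet v).ncard := by
  by_contra! hlt
  refine h.not_isCut hlt (C := {v}) ⟨⟨v, rfl⟩, ?_, ?_, ?_⟩
  · simp
  · rw [Set.nonempty_compl]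
    intro hu
    have h1 := Set.ncard_union_le {v} (G.neighborSet v)
    rw [hu, Set.ncard_univ, Set.ncard_singleton] at h1
    omega
  · rintro a rfl b hab
    exact Or.inr hab

/-- A cut stays a cut under the complement of its two parts. -/
theorem IsCut.compl {V : Type*} {G : SimpleGraph V} {X C : Set V} (h : IsCut G X C) :
    IsCut G X (C ∪ X)ᶜ := by
  obtain ⟨⟨c, hc⟩, hd, hne, hcl⟩ := h
  refine ⟨hne, Set.disjoint_left.2 fun x hx hX => hx (Or.inr hX), ⟨c, ?_⟩, ?_⟩
  · rintro (hx | hx)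
    · exact hx (Or.inl hc)
    · exact Set.disjoint_left.1 hd hc hx
  · intro a ha b hab
    by_cases hb : b ∈ C ∪ X
    · rcases hb with hb | hb
      · exact absurd (hcl b hb a hab.symm) ha
      · exact Or.inr hb
    · exact Or.inl hb

/-! ### Contractible edges in 3-connected graphs -/

theorem contractEdge_adj_of_adj {V : Type u} {G : SimpleGraph V} {u v : V}
    {x y : {x : V // x ≠ v}} (h : G.Adj x y) : (contractEdge G u v).Adj x y := by
  rw [contractEdge, SimpleGraph.fromRel_adj]
  exact ⟨fun e => h.ne (congrArg _ e), Or.inl (Or.inl h)⟩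

theorem contractEdge_adj_of_adj_right {V : Type u} {G : SimpleGraph V} {u v : V} (huv : u ≠ v)
    {y : {x : V // x ≠ v}} (hy : (y : V) ≠ u) (h : G.Adj v y) :
    (contractEdge G u v).Adj ⟨u, huv⟩ y := by
  rw [contractEdge, SimpleGraph.fromRel_adj]
  exact ⟨fun e => hy (congrArg Subtype.val e).symm, Or.inl (Or.inr ⟨rfl, h⟩)⟩

theorem contractEdge_adj {V : Type u} {G : SimpleGraph V} {u v : V} {x y : {x : V // x ≠ v}}
    (h : (contractEdge G u v).Adj x y) :
    G.Adj x y ∨ ((x : V) = u ∧ G.Adj v y) ∨ ((y : V) = u ∧ G.Adj v x) := by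
  rw [contractEdge, SimpleGraph.fromRel_adj] at h
  rcases h with ⟨-, (h | h) | (h | h)⟩
  · exact Or.inl h
  · exact Or.inr (Or.inl h)
  · exact Or.inl h.symm
  · exact Or.inr (Or.inr h)

theorem card_ne_add_one {V : Type*} [Finite V] (v : V) :
    Nat.card {x : V // x ≠ v} + 1 = Nat.card V := by
  classical
  have := Fintype.ofFinite V
  have hpos : 0 < Fintype.card V := Fintype.card_pos_iff.2 ⟨v⟩
  rw [Nat.card_eq_fintype_card, Nat.card_eq_fintype_card, Fintype.card_subtype_compl,
    Fintype.card_subtype_eq]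
  omega

/-- If contracting the edge `uv` destroys `3`-connectedness, then `u` and `v` lie in a separating
set of three vertices. -/
theorem exists_isCut_of_not_contractible {V : Type u} [Finite V] {G : SimpleGraph V}
    (hG : IsKConnected 3 G) (h4 : 4 ≤ Nat.card V) {u v : V} (huv : G.Adj u v)
    (hn : ¬ IsKConnected 3 (contractEdge G u v)) : ∃ z C, IsCut G {u, v, z} C := by
  rw [isKConnected_iff] at hn
  push Not at hn
  obtain ⟨X, C, hX, ⟨⟨c, hc⟩, hd, ⟨b, hb⟩, hcl⟩⟩ := hn (by have := card_ne_add_one v; omega)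
  have hne := huv.ne
  have hlift : (Subtype.val '' X).ncard < 3 := by
    rwa [Set.ncard_image_of_injective _ Subtype.val_injective]
  have himg : ∀ {S : Set {x : V // x ≠ v}} {x : V} (hx : x ≠ v),
      x ∈ Subtype.val '' S ↔ (⟨x, hx⟩ : {x : V // x ≠ v}) ∈ S := by
    intro S x hx
    simp [hx]
  have hv : ∀ {S : Set {x : V // x ≠ v}}, v ∉ Subtype.val '' S := by
    rintro S ⟨x, -, hx⟩
    exact x.2 hx
  have hdis : Disjoint (Subtype.val '' C) (Subtype.val '' X) :=
    (Set.disjoint_image_iff Subtype.val_injective).2 hd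
  by_cases huX : (⟨u, hne⟩ : {x : V // x ≠ v}) ∈ X
  -- `Y` is `X` together with `v`; keeping it a variable allows both `{u, v, z}` and `{u, v}` below.
  · have hcut : ∀ Y : Set V, Subtype.val '' X ⊆ Y → v ∈ Y → Y ⊆ insert v (Subtype.val '' X) →
        IsCut G Y (Subtype.val '' C) := by
      intro Y hY hvY hY'
      refine ⟨⟨c, c, hc, rfl⟩, ?_, ⟨b, ?_⟩, ?_⟩
      · rw [Set.disjoint_left]
        intro x hx hxY
        rcases hY' hxY with rfl | hxX
        · exact hv hx
        · exact Set.disjoint_left.1 hdis hx hxX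
      · rintro (hx | hx)
        · exact hb (Or.inl ((himg b.2).1 hx))
        · exact hb (Or.inr ((himg b.2).1 ((hY' hx).resolve_left b.2)))
      · rintro _ ⟨a, ha, rfl⟩ y hy
        by_cases hyv : y = v
        · subst hyv
          exact Or.inr hvY
        · rcases hcl a ha ⟨y, hyv⟩ (contractEdge_adj_of_adj hy) with h | h
          · exact Or.inl ((himg hyv).2 h)
          · exact Or.inr (hY ((himg hyv).2 h))
    by_cases hX1 : ∃ z ∈ X, z ≠ ⟨u, hne⟩
    · obtain ⟨z, hz, hzu⟩ := hX1
      have hXe : X = {⟨u, hne⟩, z} := by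
        symm
        refine Set.eq_of_subset_of_ncard_le ?_ ?_
        · rintro _ (rfl | rfl) <;> assumption
        · rw [Set.ncard_pair hzu.symm]
          omega
      refine ⟨z, _, hcut _ ?_ ?_ ?_⟩
      · rintro _ ⟨x, hx, rfl⟩
        rw [hXe] at hx
        rcases hx with rfl | rfl <;> simp
      · simp
      · rintro _ (rfl | rfl | rfl)
        · exact Or.inr ((himg hne).2 huX)
        · exact Or.inl rfl
        · exact Or.inr ((himg z.2).2 hz)
    · push Not at hX1
      exfalso
      refine hG.not_isCut (X := {u, v}) ?_ (hcut _ ?_ ?_ ?_)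
      · rw [Set.ncard_pair hne]
        omega
      · rintro _ ⟨x, hx, rfl⟩
        rw [hX1 x hx]
        simp
      · simp
      · rintro _ (rfl | rfl)
        · exact Or.inr ((himg hne).2 huX)
        · exact Or.inl rfl
  -- With `u` outside `X`, the cut lifts to `G` with the same `X`, the vertex `v` joining the side
  -- of `u`; this contradicts 3-connectedness.
  · exfalso
    by_cases huC : (⟨u, hne⟩ : {x : V // x ≠ v}) ∈ C
    · refine hG.not_isCut hlift (C := insert v (Subtype.val '' C)) ⟨⟨v, Or.inl rfl⟩, ?_, ⟨b, ?_⟩, ?_⟩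
      · rw [Set.disjoint_left]
        rintro x (rfl | hx) hxX
        · exact hv hxX
        · exact Set.disjoint_left.1 hdis hx hxX
      · rintro ((hx | hx) | hx)
        · exact b.2 hx
        · exact hb (Or.inl ((himg b.2).1 hx))
        · exact hb (Or.inr ((himg b.2).1 hx))
      · rintro a ha y hy
        by_cases hyv : y = v
        · exact Or.inl (Or.inl hyv)
        · have hyC : (⟨y, hyv⟩ : {x : V // x ≠ v}) ∈ C ∪ X := by
            rcases ha with rfl | ⟨a, ha, rfl⟩
            · by_cases hyu : y = u
              · subst hyu
                exact Or.inl huC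
              · exact hcl _ huC _ (contractEdge_adj_of_adj_right hne hyu hy)
            · exact hcl a ha _ (contractEdge_adj_of_adj hy)
          rcases hyC with h | h
          · exact Or.inl (Or.inr ((himg hyv).2 h))
          · exact Or.inr ((himg hyv).2 h)
    · refine hG.not_isCut hlift (C := Subtype.val '' C) ⟨⟨c, c, hc, rfl⟩, hdis, ⟨b, ?_⟩, ?_⟩
      · rintro (hx | hx)
        · exact hb (Or.inl ((himg b.2).1 hx))
        · exact hb (Or.inr ((himg b.2).1 hx))
      · rintro _ ⟨a, ha, rfl⟩ y hy
        by_cases hyv : y = v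
        · subst hyv
          have hau : (a : V) ≠ u := by
            intro e
            exact huC (by convert ha; exact e.symm)
          rcases hcl a ha _ (contractEdge_adj_of_adj_right hne hau hy.symm).symm with h | h
          · exact absurd h huC
          · exact absurd h huX
        · rcases hcl a ha ⟨y, hyv⟩ (contractEdge_adj_of_adj hy) with h | h
          · exact Or.inl ((himg hyv).2 h)
          · exact Or.inr ((himg hyv).2 h)

/-- A vertex of a separating set of three vertices has a neighbour in the part cut off. -/
theorem IsCut.exists_adj {V : Type*} [Finite V] {G : SimpleGraph V} (hG : IsKConnected 3 G)
    {x y z : V} {C : Set V} (h : IsCut G {x, y, z} C) : ∃ v ∈ C, G.Adj z v := by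
  by_contra! hno
  obtain ⟨hne, hd, ⟨b, hb⟩, hcl⟩ := h
  refine hG.not_isCut (X := {x, y}) (C := C) ?_ ⟨hne, ?_, ⟨b, ?_⟩, ?_⟩
  · have := Set.ncard_insert_le x {y}
    rw [Set.ncard_singleton] at this
    omega
  · refine hd.mono_right ?_
    rintro _ (rfl | rfl) <;> simp
  · rintro (hx | hx)
    · exact hb (Or.inl hx)
    · refine hb (Or.inr ?_)
      rcases hx with rfl | rfl <;> simp
  · intro a ha w haw
    rcases hcl a ha w haw with hw | rfl | rfl | rfl
    · exact Or.inl hw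
    · simp
    · simp
    · exact absurd haw.symm (hno a ha)

/-- Every `3`-connected graph with at least five vertices has an edge whose contraction is
`3`-connected. -/
theorem exists_contractible_edge {V : Type u} [Finite V] {G : SimpleGraph V}
    (hG : IsKConnected 3 G) (h5 : 5 ≤ Nat.card V) :
    ∃ u v, G.Adj u v ∧ IsKConnected 3 (contractEdge G u v) := by
  by_contra! hno
  have hcuts : ∀ u v, G.Adj u v → ∃ z C, IsCut G {u, v, z} C := fun u v huv =>
    exists_isCut_of_not_contractible hG (by omega) huv (hno u v huv)
  -- Among all edges `xy` and cuts `{x, y, z}`, take one whose side `C` is smallest; a smaller side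
  -- is then constructed.
  let P : ℕ → Prop := fun n => ∃ x y z C, G.Adj x y ∧ IsCut G {x, y, z} C ∧ C.ncard = n
  have hP : ∃ n, P n := by
    have : Nonempty V := (Nat.card_pos_iff.1 (by omega : 0 < Nat.card V)).1
    obtain ⟨v⟩ := ‹Nonempty V›
    have hdeg := hG.le_degree (by omega) v
    obtain ⟨w, hw⟩ := Set.nonempty_of_ncard_ne_zero (s := G.neighborSet v) (by omega)
    obtain ⟨z, C, hC⟩ := hcuts v w hw
    exact ⟨_, v, w, z, C, hw, hC, rfl⟩
  classical
  obtain ⟨x, y, z, C, hxy, hC, hn⟩ := Nat.find_spec hP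
  obtain ⟨v, hvC, hzv⟩ := hC.exists_adj hG
  obtain ⟨w, D₀, hD₀⟩ := hcuts z v hzv
  -- Being adjacent, `x` and `y` do not lie on opposite sides of the new cut, so one side misses
  -- both.
  obtain ⟨D, hD, hxD, hyD⟩ : ∃ D, IsCut G {z, v, w} D ∧ x ∉ D ∧ y ∉ D := by
    by_cases hx : x ∈ D₀
    · refine ⟨_, hD₀.compl, fun h => h (Or.inl hx), fun h => h (hD₀.2.2.2 x hx y hxy)⟩
    · by_cases hy : y ∈ D₀
      · refine ⟨_, hD₀.compl, fun h => h (hD₀.2.2.2 y hy x hxy.symm), fun h => h (Or.inl hy)⟩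
      · exact ⟨D₀, hD₀, hx, hy⟩
  have hperm : ({z, v, w} : Set V) = {z, w, v} := by
    rw [Set.pair_comm v w]
  obtain ⟨t, htD, hvt⟩ := IsCut.exists_adj hG (hperm ▸ hD)
  obtain ⟨-, hdD, ⟨b, hb⟩, hclD⟩ := hD
  obtain ⟨-, hdC, -, hclC⟩ := hC
  have hzD : z ∉ D := fun h => Set.disjoint_left.1 hdD h (by simp)
  have hvD : v ∉ D := fun h => Set.disjoint_left.1 hdD h (by simp)
  have htC : t ∈ C := by
    rcases hclC v hvC t hvt with h | rfl | rfl | rfl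
    · exact h
    · exact absurd htD hxD
    · exact absurd htD hyD
    · exact absurd htD hzD
  -- `D ∩ C` contains `t` but not `v ∈ C`. As `D` misses `x`, `y` and `z`, an edge leaving `D ∩ C`
  -- ends in `{z, v, w}`.
  refine Nat.find_min hP (m := (D ∩ C).ncard) ?_ ⟨z, v, w, D ∩ C, hzv, ⟨⟨t, htD, htC⟩,
    hdD.mono_left Set.inter_subset_left, ⟨b, ?_⟩, ?_⟩, rfl⟩
  · rw [← hn]
    exact Set.ncard_lt_ncard ⟨Set.inter_subset_right, fun h => hvD (h hvC).1⟩
  · rintro (h | h)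
    · exact hb (Or.inl h.1)
    · exact hb (Or.inr h)
  · rintro a ⟨haD, haC⟩ s has
    rcases hclD a haD s has with hs | hs
    · rcases hclC a haC s has with hs' | rfl | rfl | rfl
      · exact Or.inl ⟨hs, hs'⟩
      · exact absurd hs hxD
      · exact absurd hs hyD
      · exact absurd hs hzD
    · exact Or.inr hs

/-- A `3`-connected graph has `3`-connected minors of all smaller orders from `4` on. -/
theorem exists_isMinor_isKConnected {V : Type u} [Finite V] {G : SimpleGraph V}
    (hG : IsKConnected 3 G) {m : ℕ} (hm : 4 ≤ m) (hmV : m ≤ Nat.card V) :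
    ∃ (W : Type u) (H : SimpleGraph W), Finite W ∧ Nat.card W = m ∧ IsKConnected 3 H ∧
      IsMinor G H := by
  induction hmV using Nat.decreasingInduction with
  | self => exact ⟨V, G, ‹_›, rfl, hG, .iso .refl⟩
  | of_succ k hk ih =>
    obtain ⟨W, H, hW, hc, hH, hGH⟩ := ih (by omega)
    obtain ⟨u, v, huv, h3⟩ := exists_contractible_edge hH (by omega)
    exact ⟨_, _, inferInstance, by have := card_ne_add_one v; omega, h3,
      .contract hGH u v huv .refl⟩

/-! ### Matchings across a vertex partition -/

/-- A vertex cover of the edges between `A` and its complement bounds `mm G A`. -/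
theorem mm_le_ncard_of_cover {V : Type*} [Finite V] {G : SimpleGraph V} {A S : Set V}
    (hS : ∀ a ∈ A, ∀ b ∉ A, G.Adj a b → a ∈ S ∨ b ∈ S) : mm G A ≤ S.ncard := by
  refine csSup_le' ?_
  rintro _ ⟨M, hM, rfl⟩
  have hex : ∀ e ∈ M.edgeSet, ∃ v, v ∈ S ∧ v ∈ e := by
    intro e he
    induction e with
    | h x y =>
      obtain ⟨hxy, ⟨hx, hy⟩ | ⟨hx, hy⟩⟩ := M.adj_sub he
      · rcases hS x hx y hy hxy with h | h
        · exact ⟨x, h, by simp⟩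
        · exact ⟨y, h, by simp⟩
      · rcases hS y hy x hx hxy.symm with h | h
        · exact ⟨y, h, by simp⟩
        · exact ⟨x, h, by simp⟩
  rcases isEmpty_or_nonempty V with hV | hV
  · simp [Set.eq_empty_of_isEmpty]
  choose! f hfS hfe using hex
  refine Set.ncard_le_ncard_of_injOn f hfS fun e he e' he' hee => ?_
  obtain ⟨w, hw⟩ := hfe e he
  obtain ⟨w', hw'⟩ := hfe e' he'
  rw [hw, SimpleGraph.Subgraph.mem_edgeSet] at he
  rw [hw', SimpleGraph.Subgraph.mem_edgeSet, ← hee] at he'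
  rw [hw, hw', ← hee, hM.eq_of_adj_left he he']

/-- A partial injection along edges from `A` to its complement yields a matching. -/
theorem le_mm_of_injective {V : Type*} [Finite V] {G : SimpleGraph V} {A B : Set V} (hBA : B ⊆ A)
    (g : V → V) (hg : Set.InjOn g B) (hgA : ∀ a ∈ B, g a ∉ A) (hadj : ∀ a ∈ B, G.Adj a (g a)) :
    B.ncard ≤ mm G A := by
  let M : (G.between A Aᶜ).Subgraph :=
    { verts := B ∪ g '' B
      Adj := fun x y => (x ∈ B ∧ g x = y) ∨ (y ∈ B ∧ g y = x)
      adj_sub := by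
        rintro x y (⟨hx, rfl⟩ | ⟨hy, rfl⟩)
        · exact ⟨hadj x hx, Or.inl ⟨hBA hx, hgA x hx⟩⟩
        · exact ⟨(hadj y hy).symm, Or.inr ⟨hgA y hy, hBA hy⟩⟩
      edge_vert := by
        rintro x y (⟨hx, rfl⟩ | ⟨hy, rfl⟩)
        · exact Or.inl hx
        · exact Or.inr ⟨y, hy, rfl⟩
      symm := ⟨fun x y h => h.symm⟩ }
  have hM : M.IsMatching := by
    rintro v (hv | ⟨a, ha, rfl⟩)
    · refine ⟨g v, Or.inl ⟨hv, rfl⟩, ?_⟩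
      rintro w (⟨-, rfl⟩ | ⟨hw, rfl⟩)
      · rfl
      · exact absurd (hBA hv) (hgA w hw)
    · refine ⟨a, Or.inr ⟨ha, rfl⟩, ?_⟩
      rintro w (⟨h, -⟩ | ⟨hw, h⟩)
      · exact absurd (hBA h) (hgA a ha)
      · exact hg hw ha h
  have hcard : B.ncard ≤ M.edgeSet.ncard := by
    refine Set.ncard_le_ncard_of_injOn (fun a => s(a, g a)) ?_ ?_
    · intro a ha
      exact Or.inl ⟨ha, rfl⟩
    · intro a ha b hb hab
      rcases Sym2.eq_iff.1 hab with ⟨h, -⟩ | ⟨h, -⟩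
      · exact h
      · exact absurd (h ▸ hBA ha) (hgA b hb)
  refine hcard.trans (le_csSup ⟨Nat.card (Sym2 V), ?_⟩ ⟨M, hM, rfl⟩)
  rintro _ ⟨N, -, rfl⟩
  exact Set.ncard_le_card _

/-- Hall's theorem in deficiency form: add `|A| - k` dummy partners joined to all of `A`. In a
matching of all of `A`, at most that many vertices use dummies, so at least `k` are matched along
edges of `G`. -/
theorem IsKConnected.le_mm {V : Type*} [Finite V] {k : ℕ} {G : SimpleGraph V}
    (hG : IsKConnected k G) {A : Set V} (hA : k ≤ A.ncard) (hA' : k ≤ Aᶜ.ncard) :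
    k ≤ mm G A := by
  classical
  have := Fintype.ofFinite V
  let t : A → Finset (V ⊕ Fin (A.ncard - k)) := fun a =>
    (Finset.univ.filter fun b => b ∉ A ∧ G.Adj a b).disjSum Finset.univ
  have hall : ∀ s : Finset A, s.card ≤ (s.biUnion t).card := by
    intro s
    by_contra! hlt
    obtain ⟨a₀, ha₀⟩ : s.Nonempty := by
      rw [← Finset.card_pos]
      omega
    let N : Finset V := Finset.univ.filter fun b => b ∉ A ∧ ∃ a ∈ s, G.Adj a b
    have hsub : N.disjSum (Finset.univ : Finset (Fin (A.ncard - k))) ⊆ s.biUnion t := by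
      intro x hx
      rw [Finset.mem_biUnion]
      rcases Finset.mem_disjSum.1 hx with ⟨b, hb, rfl⟩ | ⟨i, -, rfl⟩
      · obtain ⟨-, hbA, a, ha, hab⟩ := Finset.mem_filter.1 hb
        exact ⟨a, ha, Finset.inl_mem_disjSum.2 (by simp [hbA, hab])⟩
      · exact ⟨a₀, ha₀, Finset.inr_mem_disjSum.2 (Finset.mem_univ _)⟩
    have hN := Finset.card_le_card hsub
    rw [Finset.card_disjSum, Finset.card_univ, Fintype.card_fin] at hN
    let S : Set V := Subtype.val '' (s : Set A)
    have hSA : S ⊆ A := by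
      rintro _ ⟨x, -, rfl⟩
      exact x.2
    have hScard : S.ncard = s.card := by
      rw [Set.ncard_image_of_injective _ Subtype.val_injective, Set.ncard_coe_finset]
    have hdiff : (A \ S).ncard + S.ncard = A.ncard := Set.ncard_sdiff_add_ncard_of_subset hSA
    -- A violation of Hall's condition reads `|A \ S| + |N| < k`, and these vertices cut `S` off.
    refine hG.not_isCut (X := (A \ S) ∪ (N : Set V)) (C := S) ?_ ⟨⟨a₀, a₀, ha₀, rfl⟩, ?_, ?_, ?_⟩
    · refine (Set.ncard_union_le _ _).trans_lt ?_
      rw [Set.ncard_coe_finset]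
      omega
    · rw [Set.disjoint_left]
      rintro x hx (h | h)
      · exact h.2 hx
      · exact (Finset.mem_filter.1 h).2.1 (hSA hx)
    -- Since `|N| < k ≤ |Aᶜ|`, a vertex lies beyond the cut.
    · have hlt' : (N : Set V).ncard < Aᶜ.ncard := by
        rw [Set.ncard_coe_finset]
        omega
      obtain ⟨b, hb, hbN⟩ := Set.exists_mem_notMem_of_ncard_lt_ncard hlt'
      refine ⟨b, ?_⟩
      rintro (h | h | h)
      · exact hb (hSA h)
      · exact hb h.1
      · exact hbN h
    · rintro _ ⟨a, ha, rfl⟩ b hab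
      by_cases hb : b ∈ A
      · by_cases hbS : b ∈ S
        · exact Or.inl hbS
        · exact Or.inr (Or.inl ⟨hb, hbS⟩)
      · exact Or.inr (Or.inr (by simpa [N] using ⟨hb, a, ⟨a.2, ha⟩, hab⟩))
  obtain ⟨f, hf, hft⟩ := (Finset.all_card_le_biUnion_card_iff_exists_injective t).1 hall
  let B : Set A := {a | ∃ b, f a = Sum.inl b}
  have hBc : Bᶜ.ncard ≤ A.ncard - k := by
    have h1 : ∀ a ∈ Bᶜ, ∃ i, f a = Sum.inr i := by
      intro a ha
      rcases h : f a with b | i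
      · exact absurd ⟨b, h⟩ ha
      · exact ⟨i, rfl⟩
    by_cases hne : Nonempty (Fin (A.ncard - k))
    · choose! i hi using h1
      have h2 : Set.InjOn i Bᶜ := fun a ha b hb hab => hf (by rw [hi a ha, hi b hb, hab])
      have h3 := Set.ncard_le_ncard_of_injOn (t := Set.univ) i (fun _ _ => Set.mem_univ _) h2
      simpa [Set.ncard_univ] using h3
    · have h4 : Bᶜ = ∅ := by
        refine Set.eq_empty_of_forall_notMem fun a ha => hne ⟨?_⟩
        rcases h : f a with b | i
        · exact absurd ⟨b, h⟩ ha
        · exact i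
      simp [h4]
  have hBk : k ≤ B.ncard := by
    have h1 := Set.ncard_add_ncard_compl B
    rw [Nat.card_coe_set_eq] at h1
    omega
  let g : V → V := fun x => if h : x ∈ A then (f ⟨x, h⟩).elim id (fun _ => x) else x
  have hgB : ∀ a ∈ B, f a = Sum.inl (g a) := by
    rintro a ⟨b, hb⟩
    simp [g, hb]
  rw [← Set.ncard_image_of_injective B Subtype.val_injective] at hBk
  refine hBk.trans (le_mm_of_injective ?_ g ?_ ?_ ?_)
  · rintro _ ⟨a, -, rfl⟩
    exact a.2
  · rintro _ ⟨a, ha, rfl⟩ _ ⟨b, hb, rfl⟩ hab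
    rw [hf ((hgB a ha).trans ((congrArg _ hab).trans (hgB b hb).symm))]
  all_goals
    rintro _ ⟨a, ha, rfl⟩
    have h1 := hft a
    rw [hgB a ha, Finset.inl_mem_disjSum, Finset.mem_filter] at h1
  · exact h1.2.1
  · exact h1.2.2

/-! ### Balanced edges of branch-decompositions -/

section Tree

variable {N : Type*} {T : SimpleGraph N}

theorem reachable_deleteEdges_of_notMem_support {H : SimpleGraph N} (hHT : H ≤ T) {a x y : N}
    (p : H.Walk x y) (ha : a ∉ p.support) (b : N) :
    (T.deleteEdges {s(a, b)}).Reachable x y := by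
  refine ⟨p.transfer _ fun e he => ?_⟩
  have heH := p.edges_subset_edgeSet he
  rw [SimpleGraph.edgeSet_deleteEdges]
  refine ⟨SimpleGraph.edgeSet_mono hHT heH, ?_⟩
  rintro rfl
  exact ha (p.fst_mem_support_of_mem_edges he)

theorem exists_reachable_of_ne {a b t : N}
    (h : (T.deleteEdges {s(a, b)}).Reachable a t) (hta : t ≠ a) :
    ∃ c, T.Adj a c ∧ c ≠ b ∧ (T.deleteEdges {s(c, a)}).Reachable c t := by
  classical
  obtain ⟨p⟩ := h
  obtain ⟨p, hp⟩ := p.toPath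
  cases p with
  | nil => exact absurd rfl hta
  | @cons _ c _ hac q =>
    rw [SimpleGraph.Walk.cons_isPath_iff] at hp
    rw [SimpleGraph.deleteEdges_adj] at hac
    refine ⟨c, hac.1, ?_, ?_⟩
    · rintro rfl
      exact hac.2 rfl
    · rw [Sym2.eq_swap]
      exact reachable_deleteEdges_of_notMem_support (T.deleteEdges_le _) q hp.2 c

theorem not_reachable_deleteEdges (hT : T.IsAcyclic) {a c : N} (hac : T.Adj a c) :
    ¬ (T.deleteEdges {s(c, a)}).Reachable c a := by
  have := SimpleGraph.isAcyclic_iff_forall_adj_isBridge.1 hT hac.symm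
  exact SimpleGraph.isBridge_iff.1 this

/-- A walk from `c` that avoids the edge `ca` never meets `a`, because that edge is a bridge; hence
it also avoids `ab`. -/
theorem reachable_of_reachable (hT : T.IsAcyclic) {a b c t : N} (hac : T.Adj a c) (hcb : c ≠ b)
    (h : (T.deleteEdges {s(c, a)}).Reachable c t) :
    (T.deleteEdges {s(a, b)}).Reachable a t := by
  classical
  obtain ⟨q⟩ := h
  have ha : a ∉ q.support := fun ha =>
    not_reachable_deleteEdges hT hac ⟨q.takeUntil a ha⟩
  refine SimpleGraph.Reachable.trans (SimpleGraph.Adj.reachable ?_)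
    (reachable_deleteEdges_of_notMem_support (T.deleteEdges_le _) q ha b)
  rw [SimpleGraph.deleteEdges_adj]
  refine ⟨hac, fun h => ?_⟩
  rcases Sym2.eq_iff.1 h with ⟨-, h⟩ | ⟨h, h'⟩
  · exact hcb h
  · exact hac.ne h'.symm

theorem reachable_or_reachable (hT : T.Connected) (a b t : N) :
    (T.deleteEdges {s(a, b)}).Reachable a t ∨ (T.deleteEdges {s(a, b)}).Reachable b t := by
  have h := (SimpleGraph.reachable_iff_reflTransGen a t).1 (hT.preconnected a t)
  induction h with
  | refl => exact Or.inl .rfl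
  | @tail y z _ hyz ih =>
    by_cases he : s(y, z) = s(a, b)
    · rcases Sym2.eq_iff.1 he with ⟨-, rfl⟩ | ⟨-, rfl⟩
      · exact Or.inr .rfl
      · exact Or.inl .rfl
    · have hadj : (T.deleteEdges {s(a, b)}).Adj y z := by
        rw [SimpleGraph.deleteEdges_adj]
        exact ⟨hyz, he⟩
      exact ih.imp (·.trans hadj.reachable) (·.trans hadj.reachable)

end Tree

namespace BranchDecomposition

variable {X : Type u} (D : BranchDecomposition X)

theorem side_union_side (a b : D.Node) : D.side a b ∪ D.side b a = Set.univ := by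
  refine Set.eq_univ_of_forall fun x => ?_
  refine (reachable_or_reachable D.isTree.1 a b (D.label.symm x)).imp id fun h => ?_
  rw [Sym2.eq_swap] at h
  exact h

theorem compl_side_subset (a b : D.Node) : (D.side a b)ᶜ ⊆ D.side b a := by
  rw [Set.compl_subset_iff_union]
  exact D.side_union_side a b

/-- The side of `a` splits into the sides of the neighbours of `a` other than `b`. -/
theorem side_subset (a b : D.Node) :
    D.side a b ⊆ {x | (D.label.symm x : D.Node) = a} ∪
      ⋃ c ∈ D.tree.neighborSet a \ {b}, D.side c a := by
  intro x hx
  by_cases hxa : (D.label.symm x : D.Node) = a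
  · exact Or.inl hxa
  · obtain ⟨c, hac, hcb, hc⟩ := exists_reachable_of_ne hx hxa
    refine Or.inr ?_
    simp only [Set.mem_iUnion]
    exact ⟨c, ⟨hac, hcb⟩, hc⟩

/-- Among the oriented edges whose tail side has at least `k` labels, take one with the smallest
tail component. The tail has two further branches with at most `k - 1` labels each, so its side has
at most `2k - 2`, leaving at least `k` of the `3k - 2`. -/
theorem exists_balanced [Finite X] {k : ℕ} (hk : 2 ≤ k) (hX : 3 * k - 2 ≤ Nat.card X) :
    ∃ d : D.tree.Dart, k ≤ (D.side d.fst d.snd).ncard ∧ k ≤ (D.side d.fst d.snd)ᶜ.ncard := by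
  classical
  have := D.finite_node
  -- Minimality is measured in nodes, not labels: moving on to a branch at `a` visibly loses the
  -- node `a`.
  let comp : D.Node → D.Node → Set D.Node := fun a b =>
    {t | (D.tree.deleteEdges {s(a, b)}).Reachable a t}
  let P : ℕ → Prop := fun n => ∃ a b, D.tree.Adj a b ∧ k ≤ (D.side a b).ncard ∧
    (comp a b).ncard = n
  have hP : ∃ n, P n := by
    have hne : Nonempty X := (Nat.card_pos_iff.1 (by omega : 0 < Nat.card X)).1
    obtain ⟨x⟩ := hne
    have hleaf : (D.tree.neighborSet (D.label.symm x)).ncard = 1 := (D.label.symm x).2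
    obtain ⟨b, hb⟩ := Set.nonempty_of_ncard_ne_zero
      (s := D.tree.neighborSet (D.label.symm x)) (by omega)
    have hun := Set.ncard_union_le (D.side (D.label.symm x) b) (D.side b (D.label.symm x))
    rw [side_union_side, Set.ncard_univ] at hun
    by_cases h : k ≤ (D.side (D.label.symm x) b).ncard
    · exact ⟨_, _, _, hb, h, rfl⟩
    · exact ⟨_, _, _, hb.symm, by omega, rfl⟩
  obtain ⟨a, b, hab, hside, hn⟩ := Nat.find_spec hP
  have hsmall : ∀ c ∈ D.tree.neighborSet a \ {b}, (D.side c a).ncard < k := by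
    rintro c ⟨hac, hcb⟩
    by_contra! hc
    refine Nat.find_min hP (m := (comp c a).ncard) ?_ ⟨c, a, hac.symm, hc, rfl⟩
    rw [← hn]
    refine Set.ncard_lt_ncard ⟨fun t ht => ?_, fun h => ?_⟩
    · exact reachable_of_reachable D.isTree.2 hac hcb ht
    · exact not_reachable_deleteEdges D.isTree.2 hac (h (SimpleGraph.Reachable.rfl : a ∈ comp a b))
  refine ⟨⟨(a, b), hab⟩, hside, ?_⟩
  have hbound : (D.side a b).ncard ≤ 2 * k - 2 := by
    -- If `a` is a leaf, its side has at most one label; `k ≥ 2` puts this within the bound.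
    rcases D.subcubic a with h1 | h3
    · have hempty : D.tree.neighborSet a \ {b} = ∅ := by
        obtain ⟨c, hc⟩ := Set.ncard_eq_one.1 h1
        have : b ∈ D.tree.neighborSet a := hab
        rw [hc] at this ⊢
        rw [this, Set.sdiff_self]
      have hsub := D.side_subset a b
      rw [hempty] at hsub
      have hle : (D.side a b).ncard ≤ 1 := by
        rw [Set.ncard_le_one]
        intro x hx y hy
        have hx' : (D.label.symm x : D.Node) = a := by simpa using hsub hx
        have hy' : (D.label.symm y : D.Node) = a := by simpa using hsub hy
        exact D.label.symm.injective (Subtype.ext (hx'.trans hy'.symm))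
      omega
    · have h2 : (D.tree.neighborSet a \ {b}).ncard = 2 := by
        rw [Set.ncard_sdiff_singleton_of_mem (show b ∈ D.tree.neighborSet a from hab)]
        omega
      obtain ⟨c, d, -, hcd⟩ := Set.ncard_eq_two.1 h2
      have hsub : D.side a b ⊆ D.side c a ∪ D.side d a := by
        intro x hx
        rcases D.side_subset a b hx with h | h
        · have hl : (D.tree.neighborSet (D.label.symm x)).ncard = 1 := (D.label.symm x).2
          have h : (D.label.symm x : D.Node) = a := h
          rw [h] at hl
          omega
        · simpa [hcd] using h
      have hc := hsmall c (by simp [hcd])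
      have hd := hsmall d (by simp [hcd])
      have h4 := (Set.ncard_le_ncard hsub).trans (Set.ncard_union_le _ _)
      omega
  have := Set.ncard_add_ncard_compl (D.side a b)
  show k ≤ (D.side a b)ᶜ.ncard
  omega

theorem le_width [Finite X] (f : Set X → ℕ) (d : D.tree.Dart) :
    f (D.side d.fst d.snd) ≤ D.width f := by
  have := D.finite_node
  have : Finite D.tree.Dart :=
    Finite.of_injective SimpleGraph.Dart.toProd SimpleGraph.Dart.toProd_injective
  exact le_ciSup (f := fun d : D.tree.Dart => f (D.side d.fst d.snd))
    (Set.finite_range _).bddAbove d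

end BranchDecomposition

/-- `k`-connected graphs with at least `3 * k - 2` vertices have maximum matching width
at least `k`. -/
theorem IsKConnected.le_mmw {V : Type u} [Finite V] {k : ℕ} {G : SimpleGraph V}
    (hG : IsKConnected k G) (hk : 2 ≤ k) (hV : 3 * k - 2 ≤ Nat.card V)
    (hD : Nonempty (BranchDecomposition V)) : k ≤ mmw G := by
  -- A decomposition must exist, as the infimum of the empty set is `0`.
  refine le_csInf ⟨_, hD.some, rfl⟩ ?_
  rintro _ ⟨D, rfl⟩
  obtain ⟨d, h1, h2⟩ := D.exists_balanced hk hV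
  exact (hG.le_mm h1 h2).trans (D.le_width _ d)

/-! ### Upper bounds from explicit decompositions -/

theorem mm_compl {V : Type*} (G : SimpleGraph V) (A : Set V) : mm G Aᶜ = mm G A := by
  rw [mm, mm, compl_compl, SimpleGraph.between_comm]

theorem mm_le_ncard {V : Type*} [Finite V] (G : SimpleGraph V) (A : Set V) : mm G A ≤ A.ncard :=
  mm_le_ncard_of_cover fun _ ha _ _ _ => Or.inl ha

theorem mmw_le_width {V : Type u} (G : SimpleGraph V) (D : BranchDecomposition V) :
    mmw G ≤ D.width (mm G) :=
  Nat.sInf_le ⟨D, rfl⟩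

theorem mmw_le_of_forall_mm_le {V : Type u} {G : SimpleGraph V} {k : ℕ} (h : ∀ A, mm G A ≤ k) :
    mmw G ≤ k := by
  rcases isEmpty_or_nonempty (BranchDecomposition V) with hD | ⟨⟨D⟩⟩
  · have : {w | ∃ D : BranchDecomposition V, D.width (mm G) = w} = ∅ :=
      Set.eq_empty_of_forall_notMem fun _ ⟨D, _⟩ => hD.elim D
    rw [mmw, fWidth, this, Nat.sInf_empty]
    exact Nat.zero_le k
  · exact (mmw_le_width G D).trans (ciSup_le' fun d => h _)

/-- The graph on `Fin (m + 1)` in which every vertex is joined to its parent. -/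
def parentGraph {m : ℕ} (p : Fin (m + 1) → Fin (m + 1)) : SimpleGraph (Fin (m + 1)) :=
  SimpleGraph.fromRel fun i j => j = p i

instance {m : ℕ} (p : Fin (m + 1) → Fin (m + 1)) : DecidableRel (parentGraph p).Adj :=
  inferInstanceAs (DecidableRel (SimpleGraph.fromRel fun i j => j = p i).Adj)

/-- `p` is the parent function of a cubic tree with root `m` whose leaves are the vertices
below `n`. -/
structure IsCubicParent {m : ℕ} (n : ℕ) (p : Fin (m + 1) → Fin (m + 1)) : Prop where
  last : p (Fin.last m) = Fin.last m
  lt : ∀ i ≠ Fin.last m, i < p i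
  le : n ≤ m + 1
  degree : ∀ i, (parentGraph p).degree i = if i.val < n then 1 else 3

/-- The leaves below the vertex `i`. -/
def leavesBelow {m : ℕ} (n : ℕ) (p : Fin (m + 1) → Fin (m + 1)) (i : Fin (m + 1)) :
    Set (Fin n) :=
  {l | ∃ k, ∃ j, j.val = l.val ∧ p^[k] j = i}

section ParentGraph

variable {m n : ℕ} {p : Fin (m + 1) → Fin (m + 1)}

theorem parentGraph_adj {i j : Fin (m + 1)} :
    (parentGraph p).Adj i j ↔ i ≠ j ∧ (j = p i ∨ i = p j) :=
  SimpleGraph.fromRel_adj _ _ _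

theorem IsCubicParent.ne_last (h : IsCubicParent n p) {i : Fin (m + 1)} (hi : i ≠ p i) :
    i ≠ Fin.last m := by
  rintro rfl
  exact hi h.last.symm

/-- Parents increase, so every vertex climbs to the root. Only non-root vertices contribute an edge
to their parent: a connected graph on `m + 1` vertices with at most `m` edges. -/
theorem IsCubicParent.isTree (h : IsCubicParent n p) : (parentGraph p).IsTree := by
  have hreach : ∀ i, (parentGraph p).Reachable i (Fin.last m) := by
    intro i
    induction i using WellFoundedGT.induction with
    | ind i ih =>
      by_cases hi : i = Fin.last m
      · rw [hi]
      · have hlt := h.lt i hi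
        exact (SimpleGraph.Adj.reachable (parentGraph_adj.2 ⟨hlt.ne, Or.inl rfl⟩)).trans
          (ih _ hlt)
  have hconn : (parentGraph p).Connected := ⟨fun i j => (hreach i).trans (hreach j).symm⟩
  rw [SimpleGraph.isTree_iff_connected_and_card]
  refine ⟨hconn, le_antisymm ?_ hconn.card_vert_le_card_edgeSet_add_one⟩
  have hsub : (parentGraph p).edgeSet ⊆ (fun i => s(i, p i)) '' {i | i ≠ Fin.last m} := by
    intro e he
    induction e with
    | h i j =>
      have he : (parentGraph p).Adj i j := he
      obtain ⟨hne, rfl | rfl⟩ := parentGraph_adj.1 he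
      · exact ⟨i, h.ne_last hne, rfl⟩
      · exact ⟨j, h.ne_last hne.symm, Sym2.eq_swap⟩
  have h1 := (Set.ncard_le_ncard hsub).trans (Set.ncard_image_le (Set.toFinite _))
  have h2 : {i | i ≠ Fin.last m}.ncard = m := by
    have := Set.ncard_add_ncard_compl {Fin.last m}
    rw [Set.ncard_singleton, Nat.card_eq_fintype_card, Fintype.card_fin] at this
    have h3 : ({Fin.last m}ᶜ : Set (Fin (m + 1))) = {i | i ≠ Fin.last m} := rfl
    rw [h3] at this
    omega
  rw [Nat.card_coe_set_eq, Nat.card_eq_fintype_card, Fintype.card_fin]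
  omega

theorem IsCubicParent.ncard_neighborSet (h : IsCubicParent n p) (i : Fin (m + 1)) :
    ((parentGraph p).neighborSet i).ncard = if i.val < n then 1 else 3 := by
  rw [← h.degree i, Set.ncard_eq_toFinset_card']
  rfl

theorem IsCubicParent.mem_leaves (h : IsCubicParent n p) (i : Fin (m + 1)) :
    i ∈ leaves (parentGraph p) ↔ i.val < n := by
  change ((parentGraph p).neighborSet i).ncard = 1 ↔ _
  rw [h.ncard_neighborSet]
  split_ifs with hi <;> simp [hi]

/-- The branch-decomposition given by a cubic tree and a labelling of its leaves. -/
def IsCubicParent.decomposition {X : Type u} (h : IsCubicParent n p) (e : Fin n ≃ X) :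
    BranchDecomposition X where
  Node := Fin (m + 1)
  finite_node := inferInstance
  tree := parentGraph p
  isTree := h.isTree
  subcubic i := by
    rw [h.ncard_neighborSet]
    split_ifs <;> simp
  label := Equiv.trans
    { toFun := fun i => ⟨i.1.val, (h.mem_leaves i.1).1 i.2⟩
      invFun := fun l => ⟨⟨l.val, l.2.trans_le h.le⟩, (h.mem_leaves _).2 l.2⟩
      left_inv := fun _ => rfl
      right_inv := fun _ => rfl } e

/-- Without the edge from `i` to its parent, a walk from `i` cannot leave the descendants of `i`. -/
theorem exists_iterate_eq_of_reachable {i t : Fin (m + 1)}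
    (ht : ((parentGraph p).deleteEdges {s(i, p i)}).Reachable i t) : ∃ k, p^[k] t = i := by
  rw [SimpleGraph.reachable_iff_reflTransGen] at ht
  induction ht with
  | refl => exact ⟨0, rfl⟩
  | @tail y z _ hyz ih =>
    obtain ⟨k, hk⟩ := ih
    rw [SimpleGraph.deleteEdges_adj, parentGraph_adj] at hyz
    obtain ⟨⟨hne, rfl | rfl⟩, hmem⟩ := hyz
    · cases k with
      | zero =>
        rw [Function.iterate_zero, id] at hk
        subst hk
        exact absurd rfl hmem
      | succ k => exact ⟨k, hk⟩
    · exact ⟨k + 1, hk⟩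

theorem IsCubicParent.side_subset {X : Type u} (h : IsCubicParent n p) (e : Fin n ≃ X)
    (i : Fin (m + 1)) : (h.decomposition e).side i (p i) ⊆ e '' leavesBelow n p i := by
  intro x hx
  obtain ⟨k, hk⟩ := exists_iterate_eq_of_reachable hx
  exact ⟨e.symm x, ⟨k, _, rfl, hk⟩, e.apply_symm_apply x⟩

/-- Quantifying over all subsets `A` makes the inclusion of a side in the leaves below suffice;
`mm_compl` handles the opposite orientation. -/
theorem IsCubicParent.mmw_le {V : Type u} {G : SimpleGraph V} {w : ℕ} (h : IsCubicParent n p)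
    (e : Fin n ≃ V)
    (hw : ∀ i ≠ Fin.last m, ∀ A ⊆ e '' leavesBelow n p i, mm G A ≤ w) : mmw G ≤ w := by
  refine (mmw_le_width G (h.decomposition e)).trans (ciSup_le' ?_)
  rintro ⟨⟨i, j⟩, hij⟩
  have hij' : (parentGraph p).Adj i j := hij
  change mm G ((h.decomposition e).side i j) ≤ w
  obtain ⟨hne, rfl | rfl⟩ := parentGraph_adj.1 hij'
  · exact hw i (h.ne_last hne) _ (h.side_subset e i)
  · rw [← mm_compl]
    exact hw j (h.ne_last hne.symm) _
      (((h.decomposition e).compl_side_subset _ _).trans (h.side_subset e j))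

/-- A bound `K` on the height turns the leaves below into a finite set that can be evaluated. -/
theorem IsCubicParent.leavesBelow_subset (h : IsCubicParent n p) {K : ℕ}
    (hK : ∀ j, p^[K] j = Fin.last m) {i : Fin (m + 1)} (hi : i ≠ Fin.last m) :
    leavesBelow n p i ⊆
      (Finset.univ.filter fun l : Fin n => ∃ k ∈ Finset.range K, p^[k] (l.castLE h.le) = i) := by
  rintro l ⟨k, j, hj, hk⟩
  obtain rfl : j = l.castLE h.le := Fin.ext hj
  have hkK : k < K := by
    by_contra! hle
    obtain ⟨d, rfl⟩ := Nat.exists_eq_add_of_le' hle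
    rw [Function.iterate_add_apply, hK, Function.iterate_fixed h.last] at hk
    exact hi hk.symm
  simp only [Finset.coe_filter, Finset.mem_univ, true_and, Finset.mem_range]
  exact ⟨k, hkK, hk⟩

end ParentGraph

/-- The tree with three cherries. -/
def parentSix : Fin 10 → Fin 10 := ![6, 6, 7, 7, 8, 8, 9, 9, 9, 9]

theorem isCubicParent_parentSix : IsCubicParent 6 parentSix :=
  ⟨by decide, by decide, by decide, by decide +kernel⟩

/-- The tree whose branches at the root have the leaves `{0, 1, 2}`, `{3, 4}` and `{5, 6}`. -/
def parentSeven : Fin 12 → Fin 12 := ![7, 7, 8, 9, 9, 10, 10, 8, 11, 11, 11, 11]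

theorem isCubicParent_parentSeven : IsCubicParent 7 parentSeven :=
  ⟨by decide, by decide, by decide, by decide +kernel⟩

theorem mm_le_two_of_ncard_le {V : Type u} [Finite V] {n : ℕ} (G : SimpleGraph V) (e : Fin n ≃ V)
    {S : Set (Fin n)} (hS : S.ncard ≤ 2) {A : Set V} (hA : A ⊆ e '' S) : mm G A ≤ 2 :=
  (mm_le_ncard G A).trans ((Set.ncard_le_ncard hA).trans
    ((Set.ncard_image_of_injective S e.injective).trans_le hS))

/-- With at most five vertices, one side of any partition has at most two. With six, each edge of
the tree with three cherries cuts off at most two leaves. -/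
theorem mmw_le_two_of_card_le_six {V : Type u} [Finite V] (G : SimpleGraph V)
    (hV : Nat.card V ≤ 6) : mmw G ≤ 2 := by
  rcases hV.lt_or_eq with h5 | h6
  · refine mmw_le_of_forall_mm_le fun A => ?_
    have h1 := mm_le_ncard G A
    have h2 := mm_le_ncard G Aᶜ
    rw [mm_compl] at h2
    have := Set.ncard_add_ncard_compl A
    omega
  · have e : Fin 6 ≃ V := (Finite.equivFinOfCardEq h6).symm
    refine isCubicParent_parentSix.mmw_le e fun i hi A hA => mm_le_two_of_ncard_le G e ?_ hA
    refine (Set.ncard_le_ncard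
      (isCubicParent_parentSix.leavesBelow_subset (K := 3) (by decide) hi)).trans ?_
    rw [Set.ncard_coe_finset]
    clear hA
    revert i
    decide +kernel

theorem exists_equiv_of_degree_le_two {V : Type u} [Finite V] {G : SimpleGraph V}
    (hV : Nat.card V = 7) {v : V} (hv : (G.neighborSet v).ncard ≤ 2) :
    ∃ e : Fin 7 ≃ V, e 0 = v ∧ G.neighborSet v ⊆ {e 1, e 2} := by
  classical
  have hsub : G.neighborSet v ⊆ {v}ᶜ := fun w hw => by
    rintro rfl
    exact G.loopless.irrefl _ hw
  have h1 := Set.ncard_add_ncard_compl {v}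
  rw [Set.ncard_singleton] at h1
  obtain ⟨S, hvS, hS, hS2⟩ := Set.exists_subsuperset_card_eq hsub hv (by omega)
  obtain ⟨a, b, hab, rfl⟩ := Set.ncard_eq_two.1 hS2
  have hav : a ≠ v := hS (by simp)
  have hbv : b ≠ v := hS (by simp)
  let e₁ : Fin 7 ≃ V := (Finite.equivFinOfCardEq hV).symm.setValue 0 v
  have h10 : e₁ 0 = v := Equiv.setValue_eq _ _ _
  let e₂ : Fin 7 ≃ V := e₁.trans (Equiv.swap (e₁ 1) a)
  have h20 : e₂ 0 = v := by
    simp only [e₂, Equiv.trans_apply, h10]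
    exact Equiv.swap_apply_of_ne_of_ne (h10 ▸ e₁.injective.ne (by decide)) hav.symm
  have h21 : e₂ 1 = a := Equiv.swap_apply_left _ _
  let e₃ : Fin 7 ≃ V := e₂.trans (Equiv.swap (e₂ 2) b)
  have h30 : e₃ 0 = v := by
    simp only [e₃, Equiv.trans_apply, h20]
    exact Equiv.swap_apply_of_ne_of_ne (h20 ▸ e₂.injective.ne (by decide)) hbv.symm
  have h31 : e₃ 1 = a := by
    simp only [e₃, Equiv.trans_apply, h21]
    exact Equiv.swap_apply_of_ne_of_ne (h21 ▸ e₂.injective.ne (by decide)) hab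
  have h32 : e₃ 2 = b := Equiv.swap_apply_left _ _
  exact ⟨e₃, h30, by rw [h31, h32]; exact hvS⟩

/-- Only one branch of the tree has three leaves. It receives `v` and two vertices that include all
neighbours of `v`; these two cover every edge leaving the branch. -/
theorem mmw_le_two_of_degree_le_two {V : Type u} [Finite V] {G : SimpleGraph V}
    (hV : Nat.card V = 7) {v : V} (hv : (G.neighborSet v).ncard ≤ 2) : mmw G ≤ 2 := by
  obtain ⟨e, rfl, hN⟩ := exists_equiv_of_degree_le_two hV hv
  refine isCubicParent_parentSeven.mmw_le e fun i hi A hA => ?_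
  have hsub := isCubicParent_parentSeven.leavesBelow_subset (K := 4) (by decide) hi
  have hcases : ∀ i ≠ Fin.last 11, (Finset.univ.filter fun l : Fin 7 =>
      ∃ k ∈ Finset.range 4, parentSeven^[k] (l.castLE isCubicParent_parentSeven.le) = i).card ≤ 2 ∨
      (Finset.univ.filter fun l : Fin 7 =>
      ∃ k ∈ Finset.range 4, parentSeven^[k] (l.castLE isCubicParent_parentSeven.le) = i) ⊆
        {0, 1, 2} := by
    decide +kernel
  rcases hcases i hi with h | h
  · refine mm_le_two_of_ncard_le G e ?_ hA
    refine (Set.ncard_le_ncard hsub).trans ?_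
    rwa [Set.ncard_coe_finset]
  · have hA' : A ⊆ {e 0, e 1, e 2} := by
      intro x hx
      obtain ⟨l, hl, rfl⟩ := hA hx
      have := h (hsub hl)
      simp only [Finset.mem_insert, Finset.mem_singleton] at this
      rcases this with rfl | rfl | rfl <;> simp
    have hle : ∀ x y : V, ({x, y} : Set V).ncard ≤ 2 := fun x y => by
      have := Set.ncard_insert_le x {y}
      rwa [Set.ncard_singleton] at this
    by_cases h2 : A.ncard ≤ 2
    · exact (mm_le_ncard G A).trans h2
    · have h3 : A = {e 0, e 1, e 2} := by
        refine Set.eq_of_subset_of_ncard_le hA' ?_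
        have h4 := Set.ncard_insert_le (e 0) {e 1, e 2}
        have h5 := hle (e 1) (e 2)
        omega
      refine (mm_le_ncard_of_cover (S := {e 1, e 2}) ?_).trans (hle _ _)
      intro a ha b hb hab
      rw [h3] at ha hb
      rcases ha with rfl | ha
      · exact absurd (Or.inr (hN hab)) hb
      · exact Or.inl ha

theorem nonempty_branchDecomposition {V : Type u} [Finite V] (hV : Nat.card V = 7) :
    Nonempty (BranchDecomposition V) :=
  ⟨isCubicParent_parentSeven.decomposition (Finite.equivFinOfCardEq hV).symm⟩

theorem IsKConnected.three_le_mmw {V : Type u} [Finite V] {G : SimpleGraph V}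
    (hG : IsKConnected 3 G) (hV : Nat.card V = 7) : 3 ≤ mmw G :=
  hG.le_mmw (by omega) (by omega) (nonempty_branchDecomposition hV)

/-! ### Enumerating vertex splits -/

/-- `G` contains the graph on `0, …, n - 1` with edge list `es`. -/
def Contains {V : Type*} (G : SimpleGraph V) (n : ℕ) (es : List (ℕ × ℕ)) : Prop :=
  ∃ f : ℕ → V, Set.InjOn f (Set.Iio n) ∧ ∀ e ∈ es, G.Adj (f e.1) (f e.2)

/-- The edges of the graph in which vertex `k` is joined to the vertices in the `k`-th list, the
lists being numbered from `k` on. -/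
def backEdges : List (List ℕ) → ℕ → List (ℕ × ℕ)
  | [], _ => []
  | js :: p, k => js.map (fun j => (k, j)) ++ backEdges p (k + 1)

/-- The neighbours of `t` in the graph with edge list `es`. -/
def neighbors (es : List (ℕ × ℕ)) (t : ℕ) : List ℕ :=
  es.filterMap fun e => bif e.1.beq t then some e.2 else bif e.2.beq t then some e.1 else none

/-- Whether `ab` is an edge of the graph with edge list `es`. -/
def hasEdge (es : List (ℕ × ℕ)) (a b : ℕ) : Bool :=
  es.any fun e => (e.1.beq a && e.2.beq b) || (e.1.beq b && e.2.beq a)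

/-- Whether the list `f` describes an embedding of the graph with edge list `L` into the graph with
edge list `es`, both on the vertices `0, …, n - 1`. -/
def isEmbedding (n : ℕ) (es L : List (ℕ × ℕ)) (f : List ℕ) : Bool :=
  f.length.beq n && f.all (fun x => Nat.blt x n) && decide f.Nodup &&
    L.all fun e => hasEdge es (f.getD e.1 0) (f.getD e.2 0)

/-- The rotation by `w` of the vertices `0, …, m - 1`; it fixes all others. -/
def rotate (m w k : ℕ) : ℕ := if k < m then (k + w) % m else k

/-- All ways of joining each vertex of a list to `u` or to `v`. -/
def distribute (u v : ℕ) : List ℕ → List (ℕ × ℕ) → List (List (ℕ × ℕ))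
  | [], es => [es]
  | b :: bs, es => distribute u v bs ((u, b) :: es) ++ distribute u v bs ((v, b) :: es)

/-- All ways of adding edges at `t` so that its degree becomes at least `3`. -/
def fillDegree (n t : ℕ) (es : List (ℕ × ℕ)) : List (List (ℕ × ℕ)) :=
  (List.sublistsLen (3 - (neighbors es t).length)
    ((List.range n).filter fun k => !(k.beq t) && !((neighbors es t).any k.beq))).map
      fun ks => ks.map (fun k => (t, k)) ++ es

/-- The minimal ways of splitting the vertex `w` into the adjacent vertices `w` and `n`, both of
degree at least `3`, up to exchanging the two. -/
def splits (n w : ℕ) (es : List (ℕ × ℕ)) : List (List (ℕ × ℕ)) :=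
  ((distribute w n (neighbors es w).tail
    (((neighbors es w).head?.toList.map fun b => (w, b)) ++
      (w, n) :: es.filter fun e => !(e.1.beq w) && !(e.2.beq w))).flatMap
        (fillDegree (n + 1) w)).flatMap (fillDegree (n + 1) n)

/-- The adjacency matrix of a graph on at most eight vertices, as a bit mask. -/
def adjMask (es : List (ℕ × ℕ)) : ℕ :=
  es.foldr (fun e g => (g.lor (Nat.shiftLeft 1 (Nat.add (Nat.mul 8 e.1) e.2))).lor
    (Nat.shiftLeft 1 (Nat.add (Nat.mul 8 e.2) e.1))) 0

/-- The vertices in `free` that are adjacent to the images `acc` of all vertices in `js`. -/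
def commonMask (g : ℕ) (acc : List ℕ) (js : List ℕ) (free : ℕ) : ℕ :=
  js.foldr (fun j c => c.land (g.shiftRight (Nat.mul 8 (acc.getD j 0)))) free

/-- Backtracking search for an extension of the partial embedding `acc`. -/
def findEmbedding (vs : List ℕ) (g : ℕ) : List (List ℕ) → List ℕ → ℕ → Option (List ℕ)
  | [], acc, _ => some acc
  | js :: p, acc, free => vs.findSome? fun x =>
      bif Nat.beq 0 ((commonMask g acc js free).land (Nat.shiftLeft 1 x)) then none
      else findEmbedding vs g p (acc ++ [x]) (free.sub (Nat.shiftLeft 1 x))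

/-- Whether the rotations of the first `m` vertices are automorphisms. -/
def isRotationInvariant (n m : ℕ) (es : List (ℕ × ℕ)) : Bool :=
  Nat.ble m n && es.all (fun e => Nat.blt e.1 n && Nat.blt e.2 n) &&
    (List.range m).all fun w => es.all fun e => hasEdge es (rotate m w e.1) (rotate m w e.2)

/-- Whether every split of a vertex in a graph of the list `Ls`, given with an order of rotational
symmetry, contains a graph of the list `Ms`. -/
def splitsContain (n : ℕ) (Ls : List (ℕ × List (List ℕ))) (Ms : List (List (List ℕ))) : Bool :=
  Ls.all fun L => isRotationInvariant n L.1 (backEdges L.2 0) &&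
    (List.range n).all fun w => (Nat.blt 0 w && Nat.blt w L.1) ||
      (splits n w (backEdges L.2 0)).all fun s => Ms.any fun M =>
        (findEmbedding (List.range (n + 1)) (adjMask s) M [] (2 ^ (n + 1) - 1)).any
          (isEmbedding (n + 1) s (backEdges M 0))

/-! ### Completeness of the enumeration -/

theorem hasEdge_eq_true {es : List (ℕ × ℕ)} {a b : ℕ} :
    hasEdge es a b = true ↔ (a, b) ∈ es ∨ (b, a) ∈ es := by
  simp only [hasEdge, List.any_eq_true, Bool.or_eq_true, Bool.and_eq_true, Nat.beq_eq]
  constructor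
  · rintro ⟨⟨x, y⟩, he, ⟨rfl, rfl⟩ | ⟨rfl, rfl⟩⟩
    · exact Or.inl he
    · exact Or.inr he
  · rintro (h | h)
    · exact ⟨_, h, Or.inl ⟨rfl, rfl⟩⟩
    · exact ⟨_, h, Or.inr ⟨rfl, rfl⟩⟩

theorem mem_neighbors {es : List (ℕ × ℕ)} {t b : ℕ} (h : b ∈ neighbors es t) :
    (t, b) ∈ es ∨ (b, t) ∈ es := by
  simp only [neighbors, List.mem_filterMap] at h
  obtain ⟨⟨x, y⟩, he, h⟩ := h
  rcases hx : x.beq t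
  · rcases hy : y.beq t
    · simp [hx, hy] at h
    · simp only [hx, hy, cond_false, cond_true, Option.some.injEq] at h
      rw [Nat.beq_eq] at hy
      subst h hy
      exact Or.inr he
  · simp only [hx, cond_true, Option.some.injEq] at h
    rw [Nat.beq_eq] at hx
    subst h hx
    exact Or.inl he

section

variable {V : Type u} {G : SimpleGraph V}

theorem adj_of_hasEdge {es : List (ℕ × ℕ)} {f : ℕ → V} (hf : ∀ e ∈ es, G.Adj (f e.1) (f e.2))
    {a b : ℕ} (h : hasEdge es a b = true) : G.Adj (f a) (f b) := by
  rcases hasEdge_eq_true.1 h with h | h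
  · exact hf _ h
  · exact (hf _ h).symm

theorem Contains.of_isEmbedding {n : ℕ} {es L : List (ℕ × ℕ)} {f : List ℕ}
    (h : isEmbedding n es L f = true) (hG : Contains G n es) : Contains G n L := by
  obtain ⟨g, hg, hadj⟩ := hG
  simp only [isEmbedding, Bool.and_eq_true, Nat.beq_eq, List.all_eq_true, decide_eq_true_eq,
    Nat.blt_eq] at h
  obtain ⟨⟨⟨hlen, hlt⟩, hnd⟩, hL⟩ := h
  refine ⟨fun k => g (f.getD k 0), fun a ha b hb hab => ?_, fun e he =>
    adj_of_hasEdge hadj (hL e he)⟩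
  have ha' : a < f.length := hlen ▸ ha
  have hb' : b < f.length := hlen ▸ hb
  simp only [List.getD_eq_getElem _ _ ha', List.getD_eq_getElem _ _ hb'] at hab
  have := hg (hlt _ (List.getElem_mem ha')) (hlt _ (List.getElem_mem hb')) hab
  exact (hnd.getElem_inj_iff).1 this

theorem rotate_lt {m w n k : ℕ} (hmn : m ≤ n) (hk : k < n) : rotate m w k < n := by
  unfold rotate
  split_ifs with h
  · exact (Nat.mod_lt _ (by omega)).trans_le hmn
  · exact hk

theorem rotate_injective (m w : ℕ) : Function.Injective (rotate m w) := by
  intro a b hab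
  unfold rotate at hab
  split_ifs at hab with ha hb hb
  · have h : a ≡ b [MOD m] := Nat.ModEq.add_right_cancel' w hab
    rwa [Nat.ModEq, Nat.mod_eq_of_lt ha, Nat.mod_eq_of_lt hb] at h
  · exact absurd (hab ▸ Nat.mod_lt _ (by omega)) hb
  · exact absurd (hab ▸ Nat.mod_lt _ (by omega)) ha
  · exact hab

theorem exists_mem_distribute {f : ℕ → V} {u v : ℕ} {bs : List ℕ} {es : List (ℕ × ℕ)}
    (hf : ∀ e ∈ es, G.Adj (f e.1) (f e.2))
    (hb : ∀ b ∈ bs, G.Adj (f u) (f b) ∨ G.Adj (f v) (f b)) :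
    ∃ s ∈ distribute u v bs es, ∀ e ∈ s, G.Adj (f e.1) (f e.2) := by
  induction bs generalizing es with
  | nil => exact ⟨es, by simp [distribute], hf⟩
  | cons b bs ih =>
    have hbs : ∀ b ∈ bs, G.Adj (f u) (f b) ∨ G.Adj (f v) (f b) := fun c hc => hb c (by simp [hc])
    have key : ∀ t, G.Adj (f t) (f b) →
        ∃ s ∈ distribute u v bs ((t, b) :: es), ∀ e ∈ s, G.Adj (f e.1) (f e.2) := by
      intro t ht
      refine ih ?_ hbs
      rintro e (_ | ⟨_, he⟩)
      · exact ht
      · exact hf e he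
    rcases hb b (by simp) with h | h
    · obtain ⟨s, hs, hs'⟩ := key u h
      exact ⟨s, by simp [distribute, hs], hs'⟩
    · obtain ⟨s, hs, hs'⟩ := key v h
      exact ⟨s, by simp [distribute, hs], hs'⟩

/-- The listed neighbours and the remaining true neighbours together number at least three, so
enough true ones remain to be added. -/
theorem exists_mem_fillDegree [Finite V] {f : ℕ → V} {n t : ℕ} {es : List (ℕ × ℕ)}
    (hsurj : ∀ x, ∃ k < n, f k = x) (hdeg : 3 ≤ (G.neighborSet (f t)).ncard)
    (hf : ∀ e ∈ es, G.Adj (f e.1) (f e.2)) :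
    ∃ s ∈ fillDegree n t es, ∀ e ∈ s, G.Adj (f e.1) (f e.2) := by
  classical
  set nb := neighbors es t with hnb
  set cands := (List.range n).filter fun k => !(k.beq t) && !(nb.any k.beq) with hcands
  set good := cands.filter fun k => decide (G.Adj (f t) (f k)) with hgood
  have hsub : G.neighborSet (f t) ⊆ f '' ((nb ++ good).toFinset : Set ℕ) := by
    intro x hx
    obtain ⟨k, hk, rfl⟩ := hsurj x
    refine ⟨k, ?_, rfl⟩
    simp only [List.toFinset_append, Finset.coe_union, Set.mem_union, Finset.mem_coe,
      List.mem_toFinset]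
    by_cases hkn : k ∈ nb
    · exact Or.inl hkn
    · refine Or.inr (List.mem_filter.2 ⟨List.mem_filter.2 ⟨List.mem_range.2 hk, ?_⟩,
        by simpa using hx⟩)
      have hkt : k ≠ t := by
        rintro rfl
        exact G.loopless.irrefl _ hx
      have hbeq : k.beq t = false := by rwa [← Bool.not_eq_true, Nat.beq_eq]
      simpa [hbeq] using fun x (hx : x ∈ nb) (e : k = x) => hkn (e ▸ hx)
  have hlen : 3 ≤ nb.length + good.length := by
    refine hdeg.trans ((Set.ncard_le_ncard hsub).trans
      ((Set.ncard_image_le (Finset.finite_toSet _)).trans ?_))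
    rw [Set.ncard_coe_finset, ← List.length_append]
    exact List.toFinset_card_le _
  refine ⟨_, List.mem_map.2 ⟨good.take (3 - nb.length), List.mem_sublistsLen.2
    ⟨(List.take_sublist _ _).trans List.filter_sublist, ?_⟩, rfl⟩, ?_⟩
  · change _ = 3 - nb.length
    rw [List.length_take]
    omega
  · intro e he
    rcases List.mem_append.1 he with he | he
    · obtain ⟨k, hk, rfl⟩ := List.mem_map.1 he
      simpa using (List.mem_filter.1 (List.mem_of_mem_take hk)).2
    · exact hf e he

theorem exists_lt_of_injOn [Finite V] {f : ℕ → V} {n : ℕ} (hf : Set.InjOn f (Set.Iio n))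
    (hcard : Nat.card V = n) (x : V) : ∃ k < n, f k = x := by
  have h : f '' Set.Iio n = Set.univ := by
    refine Set.eq_of_subset_of_ncard_le (Set.subset_univ _) ?_
    rw [hf.ncard_image, Set.ncard_univ, hcard, ← Finset.coe_Iio, Set.ncard_coe_finset,
      Nat.card_Iio]
  obtain ⟨k, hk, rfl⟩ := h.symm ▸ Set.mem_univ x
  exact ⟨k, hk, rfl⟩

/-- The graph `G` itself guides the choices: each old neighbour of `w` goes to an end adjacent to it
in `G`, and edges of `G` fill up the degrees of both ends. -/
theorem exists_mem_splits [Finite V] {f : ℕ → V} {n w : ℕ} {es : List (ℕ × ℕ)}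
    (hcard : Nat.card V = n + 1) (hdeg : ∀ v, 3 ≤ (G.neighborSet v).ncard)
    (hf : Set.InjOn f (Set.Iio (n + 1))) (hw : G.Adj (f w) (f n))
    (hes : ∀ e ∈ es, e.1 ≠ w → e.2 ≠ w → G.Adj (f e.1) (f e.2))
    (hnb : ∀ b ∈ neighbors es w, G.Adj (f w) (f b) ∨ G.Adj (f n) (f b))
    (hhead : ∀ b ∈ (neighbors es w).head?, G.Adj (f w) (f b)) :
    ∃ s ∈ splits n w es, Contains G (n + 1) s := by
  have hsurj := exists_lt_of_injOn hf hcard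
  obtain ⟨s₁, hs₁, h₁⟩ := exists_mem_distribute (G := G) (f := f) (u := w) (v := n)
    (bs := (neighbors es w).tail)
    (es := ((neighbors es w).head?.toList.map fun b => (w, b)) ++
      (w, n) :: es.filter fun e => !(e.1.beq w) && !(e.2.beq w)) (by
      intro e he
      rcases List.mem_append.1 he with he | he
      · obtain ⟨b, hb, rfl⟩ := List.mem_map.1 he
        exact hhead b (by simpa using hb)
      · rcases List.mem_cons.1 he with rfl | he
        · exact hw
        · obtain ⟨he, h⟩ := List.mem_filter.1 he
          simp only [Bool.and_eq_true, Bool.not_eq_true'] at h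
          exact hes e he (fun h' => by simp [h'] at h) (fun h' => by simp [h'] at h))
    fun b hb => hnb b (List.mem_of_mem_tail hb)
  obtain ⟨s₂, hs₂, h₂⟩ := exists_mem_fillDegree hsurj (hdeg (f w)) h₁
  obtain ⟨s₃, hs₃, h₃⟩ := exists_mem_fillDegree hsurj (hdeg (f n)) h₂
  exact ⟨s₃, List.mem_flatMap.2 ⟨s₂, List.mem_flatMap.2 ⟨s₁, hs₁, hs₂⟩, hs₃⟩, f, hf, h₃⟩

/-- A copy of a graph in the contraction pulls back to `G` with the vertex at `u` split into `u` and
`v`. Symmetry reduces the choice of the split vertex. -/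
theorem exists_mem_splits_of_contractEdge [Finite V] {n m : ℕ} {es : List (ℕ × ℕ)} {u v : V}
    (hcard : Nat.card V = n + 1) (hdeg : ∀ v, 3 ≤ (G.neighborSet v).ncard) (huv : G.Adj u v)
    (hrot : isRotationInvariant n m es = true) (hc : Contains (contractEdge G u v) n es) :
    ∃ w < n, (w = 0 ∨ m ≤ w) ∧ ∃ s ∈ splits n w es, Contains G (n + 1) s := by
  classical
  simp only [isRotationInvariant, Bool.and_eq_true, List.all_eq_true, List.mem_range] at hrot
  obtain ⟨⟨hmn, hlt⟩, hrot⟩ := hrot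
  rw [Nat.ble_eq] at hmn
  have hcard' : Nat.card {x : V // x ≠ v} = n := by
    have := card_ne_add_one v
    omega
  obtain ⟨w, hwn, hw, f, hf, hadj, hfw⟩ : ∃ w < n, (w = 0 ∨ m ≤ w) ∧
      ∃ f : ℕ → {x : V // x ≠ v}, Set.InjOn f (Set.Iio n) ∧
        (∀ e ∈ es, (contractEdge G u v).Adj (f e.1) (f e.2)) ∧ f w = ⟨u, huv.ne⟩ := by
    obtain ⟨f, hf, hadj⟩ := hc
    obtain ⟨w, hw, hfw⟩ := exists_lt_of_injOn hf hcard' ⟨u, huv.ne⟩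
    -- A rotation moves the split vertex to `0`.
    by_cases hwm : w < m
    · refine ⟨0, by omega, Or.inl rfl, fun k => f (rotate m w k), ?_, ?_, ?_⟩
      · intro a ha b hb hab
        exact rotate_injective m w (hf (rotate_lt hmn ha) (rotate_lt hmn hb) hab)
      · exact fun e he => adj_of_hasEdge hadj (hrot w hwm e he)
      · have : rotate m w 0 = w := by
          rw [rotate, if_pos (by omega), Nat.zero_add, Nat.mod_eq_of_lt hwm]
        simp only [this, hfw]
    · exact ⟨w, hw, Or.inr (by omega), f, hf, hadj, hfw⟩
  refine ⟨w, hwn, hw, ?_⟩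
  let F : ℕ → V := fun k => if k = n then v else f k
  have hFn : F n = v := if_pos rfl
  have hFlt : ∀ k, k < n → F k = f k := fun k hk => if_neg hk.ne
  have hFw : F w = u := by rw [hFlt w hwn, hfw]
  have hF : Set.InjOn F (Set.Iio (n + 1)) := by
    intro a ha b hb hab
    have ha : a < n + 1 := ha
    have hb : b < n + 1 := hb
    by_cases han : a = n <;> by_cases hbn : b = n
    · rw [han, hbn]
    · rw [han, hFn, hFlt b (by omega)] at hab
      exact absurd hab.symm (f b).2
    · rw [hbn, hFn, hFlt a (by omega)] at hab
      exact absurd hab (f a).2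
    · rw [hFlt a (by omega), hFlt b (by omega)] at hab
      exact hf (show a < n by omega) (show b < n by omega) (Subtype.ext hab)
  have hmem : ∀ e ∈ es, e.1 < n ∧ e.2 < n := by
    intro e he
    have := hlt e he
    rwa [Nat.blt_eq, Nat.blt_eq] at this
  have hne : ∀ k, k < n → k ≠ w → (f k : V) ≠ u := by
    intro k hk hkw h
    exact hkw (hf hk hwn ((Subtype.ext h).trans hfw.symm))
  have hes : ∀ e ∈ es, e.1 ≠ w → e.2 ≠ w → G.Adj (F e.1) (F e.2) := by
    intro e he h1 h2
    obtain ⟨l1, l2⟩ := hmem e he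
    rw [hFlt _ l1, hFlt _ l2]
    rcases contractEdge_adj (hadj e he) with h | ⟨h, -⟩ | ⟨h, -⟩
    · exact h
    · exact absurd h (hne _ l1 h1)
    · exact absurd h (hne _ l2 h2)
  have hnb : ∀ b ∈ neighbors es w, b < n ∧ b ≠ w ∧ (G.Adj u (F b) ∨ G.Adj v (F b)) := by
    intro b hb
    have hwb : (contractEdge G u v).Adj (f w) (f b) ∧ b < n := by
      rcases mem_neighbors hb with h | h
      · exact ⟨hadj _ h, (hmem _ h).2⟩
      · exact ⟨(hadj _ h).symm, (hmem _ h).1⟩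
    have hbw : b ≠ w := by
      rintro rfl
      exact hwb.1.ne rfl
    refine ⟨hwb.2, hbw, ?_⟩
    rw [hFlt b hwb.2]
    rcases contractEdge_adj hwb.1 with h | ⟨-, h⟩ | ⟨h, -⟩
    · rw [hfw] at h
      exact Or.inl h
    · exact Or.inr h
    · exact absurd h (hne b hwb.2 hbw)
  have hhead : (∀ b ∈ (neighbors es w).head?, G.Adj u (F b)) ∨
      (∀ b ∈ (neighbors es w).head?, G.Adj v (F b)) := by
    rcases hl : neighbors es w with _ | ⟨b, bs⟩
    · simp
    · simpa using (hnb b (by simp [hl])).2.2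
  rcases hhead with hhead | hhead
  · refine exists_mem_splits hcard hdeg hF (by rwa [hFn, hFw]) hes ?_ ?_
    · rw [hFn, hFw]
      exact fun b hb => (hnb b hb).2.2
    · rwa [hFw]
  -- The first neighbour is attached to `v`, so the numbers of `u` and `v` are exchanged.
  · have hswap : ∀ k, k < n → k ≠ w → F (Equiv.swap w n k) = F k := fun k hk hkw => by
      rw [Equiv.swap_apply_of_ne_of_ne hkw hk.ne]
    have hw' : F (Equiv.swap w n w) = v := by rw [Equiv.swap_apply_left, hFn]
    have hn' : F (Equiv.swap w n n) = u := by rw [Equiv.swap_apply_right, hFw]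
    refine exists_mem_splits (f := fun k => F (Equiv.swap w n k)) hcard hdeg ?_ ?_ ?_ ?_ ?_
    · intro a ha b hb hab
      have hlt : ∀ k, k < n + 1 → Equiv.swap w n k < n + 1 := by
        intro k hk
        rw [Equiv.swap_apply_def]
        split_ifs <;> omega
      exact (Equiv.swap w n).injective (hF (hlt a ha) (hlt b hb) hab)
    · simp only [hw', hn']
      exact huv.symm
    · intro e he h1 h2
      obtain ⟨l1, l2⟩ := hmem e he
      simp only [hswap _ l1 h1, hswap _ l2 h2]
      exact hes e he h1 h2
    · intro b hb
      obtain ⟨l, hbw, h⟩ := hnb b hb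
      simp only [hswap b l hbw, hw', hn']
      exact h.symm
    · intro b hb
      obtain ⟨l, hbw, -⟩ := hnb b (List.mem_of_mem_head? hb)
      simp only [hswap b l hbw, hw']
      exact hhead b hb

end

/-- The induction step on the order. The 3-connectedness of `G` enters only through a contractible
edge and minimum degree 3. -/
theorem exists_contains_succ {n : ℕ} {Ls : List (ℕ × List (List ℕ))} {Ms : List (List (List ℕ))}
    (hn : 4 ≤ n) (hcheck : splitsContain n Ls Ms = true)
    (hLs : ∀ (V : Type u) [Finite V] (G : SimpleGraph V), IsKConnected 3 G → Nat.card V = n →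
      ∃ L ∈ Ls.map Prod.snd, Contains G n (backEdges L 0))
    (V : Type u) [Finite V] (G : SimpleGraph V) (hG : IsKConnected 3 G)
    (hV : Nat.card V = n + 1) : ∃ M ∈ Ms, Contains G (n + 1) (backEdges M 0) := by
  obtain ⟨u, v, huv, h3⟩ := exists_contractible_edge hG (by omega)
  obtain ⟨_, hL', hc⟩ := hLs _ _ h3 (by have := card_ne_add_one v; omega)
  obtain ⟨L, hL, rfl⟩ := List.mem_map.1 hL'
  simp only [splitsContain, List.all_eq_true, Bool.and_eq_true, Bool.or_eq_true, List.any_eq_true,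
    List.mem_range, Nat.blt_eq] at hcheck
  obtain ⟨hrot, hsp⟩ := hcheck L hL
  obtain ⟨w, hwn, hw, s, hs, hGs⟩ := exists_mem_splits_of_contractEdge hV
    (fun v => hG.le_degree (by omega) v) huv hrot hc
  obtain ⟨M, hM, hemb⟩ := (hsp w hwn).resolve_left (by omega) s hs
  refine ⟨M, hM, ?_⟩
  rw [Option.any_eq_true] at hemb
  -- How `f` was found is discarded: correctness rests on `isEmbedding`, not on the search.
  obtain ⟨f, -, hf⟩ := hemb
  exact hGs.of_isEmbedding hf

/-! ### From four to seven vertices -/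

/-- The complete graph on four vertices. -/
def complete4 : List (List ℕ) := [[], [0], [0, 1], [0, 1, 2]]

/-- The wheel with four spokes. -/
def wheel4 : List (List ℕ) := [[], [0], [1], [0, 2], [0, 1, 2, 3]]

/-- The wheel with five spokes. -/
def wheel5 : List (List ℕ) := [[], [0], [1], [2], [0, 3], [0, 1, 2, 3, 4]]

/-- The triangular prism, as a circulant graph. -/
def prism : List (List ℕ) := [[], [], [0], [0, 1], [0, 1, 2], [1, 2, 3]]

/-- The complete bipartite graph with two parts of size three, as a circulant graph. -/
def utility : List (List ℕ) := [[], [0], [1], [2, 0], [3, 1], [4, 0, 2]]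

/-- The five graphs on seven vertices, with the vertices numbered in an order suited to
`findEmbedding`. -/
def minimal7 : List (List (List ℕ)) :=
  [[[], [0], [0, 1], [1, 2], [0], [3, 4], [2, 4, 5]],
   [[], [0], [0, 1], [0], [2, 3], [2, 3], [1, 4, 5]],
   [[], [0], [0, 1], [0, 2], [1, 2], [2, 4], [2, 3, 5]],
   [[], [0], [0, 1], [0], [0, 3], [1, 3], [2, 4, 5]],
   [[], [0], [1], [0, 2], [0, 2], [0, 2], [1, 3, 4, 5]]]

/-- Minimum degree 3 on four vertices leaves no non-edge. -/
theorem exists_contains_complete4 (V : Type u) [Finite V] (G : SimpleGraph V)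
    (hG : IsKConnected 3 G) (hV : Nat.card V = 4) :
    ∃ L ∈ [(4, complete4)].map Prod.snd, Contains G 4 (backEdges L 0) := by
  have e : Fin 4 ≃ V := (Finite.equivFinOfCardEq hV).symm
  have hadj : ∀ v w, v ≠ w → G.Adj v w := by
    intro v w hvw
    have hsub : G.neighborSet v ⊆ {v}ᶜ := fun x hx => by
      rintro rfl
      exact G.loopless.irrefl _ hx
    have h1 := Set.ncard_add_ncard_compl {v}
    rw [Set.ncard_singleton] at h1
    have h2 := Set.eq_of_subset_of_ncard_le hsub (by have := hG.le_degree (by omega) v; omega)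
    exact (h2.symm ▸ hvw.symm : w ∈ G.neighborSet v)
  refine ⟨complete4, by simp, fun k => e (Fin.ofNat 4 k), ?_, ?_⟩
  · intro a ha b hb hab
    have := congrArg Fin.val (e.injective hab)
    simpa [Nat.mod_eq_of_lt (show a < 4 from ha), Nat.mod_eq_of_lt (show b < 4 from hb)] using this
  · intro a ha
    refine hadj _ _ (e.injective.ne ?_)
    revert a
    decide

theorem splitsContain_wheel4 : splitsContain 4 [(4, complete4)] [wheel4] = true := by
  decide +kernel

theorem splitsContain_prism_utility_wheel5 :
    splitsContain 5 [(4, wheel4)] [prism, utility, wheel5] = true := by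
  decide +kernel

theorem splitsContain_minimal7 :
    splitsContain 6 [(6, prism), (6, utility), (5, wheel5)] minimal7 = true := by
  decide +kernel

theorem exists_contains_minimal7 (V : Type u) [Finite V] (G : SimpleGraph V)
    (hG : IsKConnected 3 G) (hV : Nat.card V = 7) :
    ∃ M ∈ minimal7, Contains G 7 (backEdges M 0) :=
  exists_contains_succ (by omega) splitsContain_minimal7
    (exists_contains_succ (by omega) splitsContain_prism_utility_wheel5
      (exists_contains_succ (by omega) splitsContain_wheel4 exists_contains_complete4)) V G hG hV

/-! ### The five graphs and edge-minimality -/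

theorem IsKConnected.mono {V : Type*} [Finite V] {k : ℕ} {G H : SimpleGraph V} (hGH : G ≤ H)
    (hG : IsKConnected k G) : IsKConnected k H := by
  rw [isKConnected_iff] at hG ⊢
  refine ⟨hG.1, fun X C hX hC => hG.2 X C hX ⟨hC.1, hC.2.1, hC.2.2.1, ?_⟩⟩
  exact fun a ha b hab => hC.2.2.2 a ha b (hGH hab)

theorem IsKConnected.of_iso {V W : Type*} [Finite V] [Finite W] {k : ℕ} {G : SimpleGraph V}
    {H : SimpleGraph W} (e : G ≃g H) (hG : IsKConnected k G) : IsKConnected k H := by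
  rw [isKConnected_iff] at hG ⊢
  refine ⟨hG.1.trans_eq (Nat.card_congr e.toEquiv), ?_⟩
  rintro X C hX ⟨⟨c, hc⟩, hd, ⟨b, hb⟩, hcl⟩
  refine hG.2 (e ⁻¹' X) (e ⁻¹' C) ?_ ⟨⟨e.symm c, ?_⟩, hd.preimage e, ⟨e.symm b, ?_⟩, ?_⟩
  · rwa [Set.ncard_preimage_of_injective_subset_range e.injective]
    rw [e.surjective.range_eq]
    exact Set.subset_univ X
  · simpa using hc
  · simpa using hb
  · exact fun a ha b hab => hcl (e a) ha (e b) (e.map_adj_iff.2 hab)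

/-- A finite test: the boundary of each nonempty `C` must be large, or nothing may lie beyond it. -/
theorem isKConnected_of_forall_finset {V : Type*} [Fintype V] [DecidableEq V] {k : ℕ}
    {G : SimpleGraph V} [DecidableRel G.Adj] (hk : k ≤ Fintype.card V)
    (h : ∀ C : Finset V, C.Nonempty →
      k ≤ (Finset.univ.filter fun b => b ∉ C ∧ ∃ a ∈ C, G.Adj a b).card ∨
        ∀ b ∉ C, ∃ a ∈ C, G.Adj a b) : IsKConnected k G := by
  classical
  rw [isKConnected_iff, Nat.card_eq_fintype_card]
  refine ⟨hk, ?_⟩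
  rintro X C hX ⟨⟨c, hc⟩, hd, ⟨b, hb⟩, hcl⟩
  rcases h C.toFinset ⟨c, by simpa using hc⟩ with h | h
  · refine absurd (h.trans ?_) hX.not_ge
    rw [← Set.ncard_coe_finset]
    refine Set.ncard_le_ncard fun b hb => ?_
    simp only [Set.mem_toFinset, Finset.coe_filter, Finset.mem_univ, true_and] at hb
    obtain ⟨hbC, a, ha, hab⟩ := hb
    exact (hcl a ha b hab).resolve_left hbC
  · obtain ⟨a, ha, hab⟩ := h b (fun h => hb (Or.inl (by simpa using h)))
    exact hb (hcl a (by simpa using ha) b hab)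

instance (i : Fin 5) : DecidableRel (obstruction i).Adj :=
  inferInstanceAs (DecidableRel (SimpleGraph.fromRel fun a b => (a, b) ∈ obstructionEdges i).Adj)

theorem isKConnected_obstruction (i : Fin 5) : IsKConnected 3 (obstruction i) := by
  refine isKConnected_of_forall_finset (by decide) ?_
  revert i
  decide +kernel

/-- The source of both kinds of minimality: losing any edge pushes some degree below 3. -/
theorem degree_obstruction_le (i : Fin 5) : ∀ a b, (obstruction i).Adj a b →
    (obstruction i).degree a ≤ 3 ∨ (obstruction i).degree b ≤ 3 := by
  revert i
  decide +kernel

/-- The number of triples of pairwise adjacent vertices. -/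
def triangleCount {V : Type*} [Fintype V] (G : SimpleGraph V) [DecidableRel G.Adj] : ℕ :=
  (Finset.univ.filter fun t : V × V × V =>
    G.Adj t.1 t.2.1 ∧ G.Adj t.1 t.2.2 ∧ G.Adj t.2.1 t.2.2).card

theorem triangleCount_eq_of_iso {V W : Type*} [Fintype V] [Fintype W] {G : SimpleGraph V}
    {H : SimpleGraph W} [DecidableRel G.Adj] [DecidableRel H.Adj] (e : G ≃g H) :
    triangleCount G = triangleCount H := by
  refine Finset.card_equiv (e.toEquiv.prodCongr (e.toEquiv.prodCongr e.toEquiv)) ?_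
  rintro ⟨a, b, c⟩
  simp [e.map_adj_iff]

theorem triangleCount_obstruction : Function.Injective fun i => triangleCount (obstruction i) := by
  -- Triples are ordered, so each triangle counts six times.
  have h : ∀ i, triangleCount (obstruction i) = ![36, 0, 6, 18, 12] i := by decide +kernel
  intro i j hij
  simp only [h] at hij
  revert i j
  decide

theorem eq_of_obstruction_iso {i j : Fin 5} (h : Nonempty (obstruction i ≃g obstruction j)) :
    i = j :=
  triangleCount_obstruction (triangleCount_eq_of_iso h.some)

/-- Translates from the numbering used in the search to that of the five given graphs. -/
theorem exists_isEmbedding_obstruction : ∀ M ∈ minimal7, ∃ i f, isEmbedding 7 (backEdges M 0)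
    ((obstructionEdges i).map fun e => (e.1.val, e.2.val)) f = true := by
  intro M hM
  simp only [minimal7, List.mem_cons, List.not_mem_nil, or_false] at hM
  rcases hM with rfl | rfl | rfl | rfl | rfl
  · exact ⟨3, [5, 4, 6, 3, 1, 0, 2], by decide⟩
  · exact ⟨2, [6, 3, 4, 5, 1, 0, 2], by decide⟩
  · exact ⟨0, [4, 5, 6, 3, 0, 1, 2], by decide⟩
  · exact ⟨4, [6, 5, 4, 3, 2, 1, 0], by decide⟩
  · exact ⟨1, [5, 4, 3, 1, 0, 6, 2], by decide⟩

/-- A `3`-connected graph on seven vertices contains one of the five graphs. -/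
theorem exists_equiv_obstruction {V : Type u} [Finite V] {G : SimpleGraph V}
    (hG : IsKConnected 3 G) (hV : Nat.card V = 7) :
    ∃ i, ∃ e : Fin 7 ≃ V, ∀ a b, (obstruction i).Adj a b → G.Adj (e a) (e b) := by
  obtain ⟨M, hM, hGM⟩ := exists_contains_minimal7 V G hG hV
  obtain ⟨i, g, hg⟩ := exists_isEmbedding_obstruction M hM
  obtain ⟨f, hf, hadj⟩ := hGM.of_isEmbedding hg
  have hinj : Function.Injective fun a : Fin 7 => f a.val := fun a b hab =>
    Fin.ext (hf a.2 b.2 hab)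
  have hbij := (Nat.bijective_iff_injective_and_card (fun a : Fin 7 => f a.val)).2
    ⟨hinj, by rw [hV, Nat.card_eq_fintype_card, Fintype.card_fin]⟩
  refine ⟨i, Equiv.ofBijective _ hbij, fun a b hab => ?_⟩
  rw [obstruction, SimpleGraph.fromRel_adj] at hab
  rcases hab.2 with h | h
  · exact hadj _ (List.mem_map.2 ⟨_, h, rfl⟩)
  · exact (hadj _ (List.mem_map.2 ⟨_, h, rfl⟩)).symm

theorem ncard_neighborSet_of_iso {V W : Type*} {G : SimpleGraph V} {H : SimpleGraph W}
    (e : G ≃g H) (v : V) : (H.neighborSet (e v)).ncard = (G.neighborSet v).ncard := by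
  rw [← Nat.card_coe_set_eq, ← Nat.card_coe_set_eq]
  exact (Nat.card_congr (e.mapNeighborSet v)).symm

theorem InO3.card_eq {V : Type u} {G : SimpleGraph V} (h : InO3 G) : Nat.card V = 7 := by
  obtain ⟨i, ⟨e⟩⟩ := h
  rw [Nat.card_congr e.toEquiv, Nat.card_eq_fintype_card, Fintype.card_fin]

theorem InO3.isKConnected {V : Type u} [Finite V] {G : SimpleGraph V} (h : InO3 G) :
    IsKConnected 3 G := by
  obtain ⟨i, ⟨e⟩⟩ := h
  exact (isKConnected_obstruction i).of_iso e.symm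

theorem InO3.degree_le {V : Type u} {G : SimpleGraph V} (h : InO3 G) {x y : V} (hxy : G.Adj x y) :
    (G.neighborSet x).ncard ≤ 3 ∨ (G.neighborSet y).ncard ≤ 3 := by
  obtain ⟨i, ⟨e⟩⟩ := h
  rw [← ncard_neighborSet_of_iso e x, ← ncard_neighborSet_of_iso e y,
    Set.ncard_eq_toFinset_card', Set.ncard_eq_toFinset_card']
  exact degree_obstruction_le i _ _ (e.map_adj_iff.2 hxy)

theorem InO3.exists_degree_le_two {V : Type u} [Finite V] {G H : SimpleGraph V} (h : InO3 G)
    (hHG : H ≤ G) {x y : V} (hxy : G.Adj x y) (hxy' : ¬ H.Adj x y) :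
    ∃ v, (H.neighborSet v).ncard ≤ 2 := by
  have key : ∀ {x y : V}, G.Adj x y → ¬ H.Adj x y → (G.neighborSet x).ncard ≤ 3 →
      (H.neighborSet x).ncard ≤ 2 := by
    intro x y hxy hxy' h3
    have : (H.neighborSet x).ncard < (G.neighborSet x).ncard :=
      Set.ncard_lt_ncard ⟨fun z hz => hHG hz, fun hsub => hxy' (hsub hxy)⟩
    omega
  rcases h.degree_le hxy with h3 | h3
  · exact ⟨x, key hxy hxy' h3⟩
  · exact ⟨y, key hxy.symm (fun h => hxy' h.symm) h3⟩

theorem InO3.isEdgeMinimal {V : Type u} [Finite V] {G : SimpleGraph V} (h : InO3 G) :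
    IsEdgeMinimal3Connected G := by
  refine ⟨h.isKConnected, fun H hH hHG x y hxy => ?_⟩
  by_contra hxy'
  obtain ⟨v, hv⟩ := h.exists_degree_le_two hHG hxy hxy'
  have h1 := IsKConnected.le_degree hH (by rw [h.card_eq]; omega) v
  omega

/-- The spanning copy of one of the five inside `G` is 3-connected, so minimality makes it all of
`G`. -/
theorem IsEdgeMinimal3Connected.inO3 {V : Type u} [Finite V] {G : SimpleGraph V}
    (h : IsEdgeMinimal3Connected G) (hV : Nat.card V = 7) : InO3 G := by
  obtain ⟨i, e, he⟩ := exists_equiv_obstruction h.prop hV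
  let H : SimpleGraph V := (obstruction i).map e.toEmbedding
  have iso : obstruction i ≃g H := SimpleGraph.Iso.map e (obstruction i)
  have hHG : H ≤ G := by
    intro x y hxy
    obtain ⟨a, b, hab, rfl, rfl⟩ := (SimpleGraph.map_adj _ _ _ _).1 hxy
    exact he a b hab
  have hGH : G = H := le_antisymm (h.2 ((isKConnected_obstruction i).of_iso iso) hHG) hHG
  rw [hGH]
  exact ⟨i, ⟨iso.symm⟩⟩

/-! ### Minors and the equivalence -/

theorem card_compl_singleton_lt {V : Type*} [Finite V] (x : V) :
    Nat.card ({x}ᶜ : Set V) < Nat.card V := by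
  rw [Nat.card_coe_set_eq]
  have := Set.ncard_add_ncard_compl {x}
  rw [Set.ncard_singleton] at this
  omega

/-- A minor of one of the five graphs has at most six vertices, or a vertex of degree at most `2`,
unless it is the graph itself. -/
theorem InO3.isMinor_cases {V : Type u} [Finite V] {G : SimpleGraph V} (h : InO3 G) {W : Type u}
    {H : SimpleGraph W} (hGH : IsMinor G H) : Finite W ∧ (Nat.card W ≤ 6 ∨ Nonempty (G ≃g H) ∨
      (Nat.card W = 7 ∧ ∃ v, (H.neighborSet v).ncard ≤ 2)) := by
  have hV := h.card_eq
  -- All three alternatives bound the order by 7, so removing or merging a vertex lands in the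
  -- first.
  have hle : ∀ {U : Type u} {K : SimpleGraph U}, Nat.card U ≤ 6 ∨ Nonempty (G ≃g K) ∨
      (Nat.card U = 7 ∧ ∃ v, (K.neighborSet v).ncard ≤ 2) → Nat.card U ≤ 7 := by
    rintro U K (hU | ⟨⟨e⟩⟩ | ⟨hU, -⟩)
    · omega
    · rw [← Nat.card_congr e.toEquiv, hV]
    · exact hU.le
  induction hGH with
  | iso e => exact ⟨Finite.of_equiv V e.toEquiv, Or.inr (Or.inl ⟨e⟩)⟩
  | @deleteEdge U U' K K' _ x y hxy e ih =>
    obtain ⟨hfin, ih⟩ := ih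
    refine ⟨Finite.of_equiv U e.toEquiv, ?_⟩
    rw [← Nat.card_congr e.toEquiv]
    rcases ih with hU | ⟨⟨e'⟩⟩ | ⟨hU, v, hv⟩
    · exact Or.inl hU
    · have hU : InO3 K := by
        obtain ⟨i, ⟨e''⟩⟩ := h
        exact ⟨i, ⟨e'.symm.trans e''⟩⟩
      obtain ⟨v, hv⟩ := hU.exists_degree_le_two (K.deleteEdges_le {s(x, y)}) hxy (by simp)
      refine Or.inr (Or.inr ⟨hU.card_eq, e v, ?_⟩)
      rwa [ncard_neighborSet_of_iso]
    · refine Or.inr (Or.inr ⟨hU, e v, ?_⟩)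
      rw [ncard_neighborSet_of_iso]
      exact (Set.ncard_le_ncard fun z hz => K.deleteEdges_le {s(x, y)} hz).trans hv
  | @deleteVertex U U' K K' _ x e ih =>
    obtain ⟨hfin, ih⟩ := ih
    refine ⟨Finite.of_equiv _ e.toEquiv, Or.inl ?_⟩
    rw [← Nat.card_congr e.toEquiv]
    have := card_compl_singleton_lt x
    have := hle ih
    omega
  | @contract U U' K K' _ x y hxy e ih =>
    obtain ⟨hfin, ih⟩ := ih
    refine ⟨Finite.of_equiv _ e.toEquiv, Or.inl ?_⟩
    rw [← Nat.card_congr e.toEquiv]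
    have := card_ne_add_one y
    have := hle ih
    omega

theorem InO3.isMinorMinimal {V : Type u} [Finite V] {G : SimpleGraph V} (h : InO3 G) :
    IsMinorMinimal (fun _ H => 3 ≤ mmw H) G := by
  refine ⟨h.isKConnected.three_le_mmw h.card_eq, fun W H ⟨hGH, hn⟩ h3 => ?_⟩
  obtain ⟨hfin, h6 | hiso | ⟨h7, v, hv⟩⟩ := h.isMinor_cases hGH
  · have := mmw_le_two_of_card_le_six H h6
    omega
  · exact hn hiso
  · have := mmw_le_two_of_degree_le_two h7 hv
    omega

theorem not_iso_deleteEdges {V : Type*} [Finite V] {G : SimpleGraph V} {x y : V}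
    (hxy : G.Adj x y) : ¬ Nonempty (G ≃g G.deleteEdges {s(x, y)}) := by
  rintro ⟨e⟩
  have h1 := Nat.card_congr e.mapEdgeSet
  rw [Nat.card_coe_set_eq, Nat.card_coe_set_eq, SimpleGraph.edgeSet_deleteEdges] at h1
  have h2 : (G.edgeSet \ {s(x, y)}).ncard < G.edgeSet.ncard :=
    Set.ncard_sdiff_singleton_lt_of_mem hxy
  omega

/-- Fewer than seven vertices give width at most 2; with more than seven, a 3-connected minor on
seven vertices is proper and still has width at least 3. -/
theorem IsKConnected.inO3_of_isMinorMinimal {V : Type u} [Finite V] {G : SimpleGraph V}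
    (hG : IsKConnected 3 G) (hmin : IsMinorMinimal (fun _ H => 3 ≤ mmw H) G) : InO3 G := by
  have h7 : 7 ≤ Nat.card V := by
    by_contra! hlt
    have := mmw_le_two_of_card_le_six G (by omega)
    have h3 : 3 ≤ mmw G := hmin.1
    omega
  have hV : Nat.card V = 7 := by
    by_contra hne
    obtain ⟨W, H, hfin, hW, hH, hGH⟩ := exists_isMinor_isKConnected hG (by omega) h7
    refine hmin.2 W H ⟨hGH, ?_⟩ (hH.three_le_mmw hW)
    rintro ⟨e⟩
    exact hne ((Nat.card_congr e.toEquiv).trans hW)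
  refine IsEdgeMinimal3Connected.inO3 ⟨hG, fun H hH hHG x y hxy => ?_⟩ hV
  by_contra hxy'
  -- If a 3-connected spanning subgraph `H` misses `xy`, deleting `xy` alone keeps 3-connectedness,
  -- and with it width at least 3.
  refine hmin.2 V (G.deleteEdges {s(x, y)})
    ⟨.deleteEdge (.iso .refl) x y hxy .refl, not_iso_deleteEdges hxy⟩
    (IsKConnected.three_le_mmw (IsKConnected.mono (fun a b hab => ?_) hH) hV)
  rw [SimpleGraph.deleteEdges_adj]
  refine ⟨hHG hab, fun he => hxy' ?_⟩
  rwa [← SimpleGraph.mem_edgeSet, ← Set.mem_singleton_iff.1 he]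

end MMWidth

theorem lemma3p2 {V : Type*} [Finite V] (G : SimpleGraph V) :
    (MMWidth.IsKConnected 3 G →
      (MMWidth.IsMinorMinimal (fun _ H => 3 ≤ MMWidth.mmw H) G ↔ MMWidth.InO3 G)) ∧
    (MMWidth.InO3 G ↔ Nat.card V = 7 ∧ MMWidth.IsEdgeMinimal3Connected G) ∧
    (∀ i j : Fin 5,
      Nonempty (MMWidth.obstruction i ≃g MMWidth.obstruction j) → i = j) :=
  ⟨fun hG => ⟨hG.inO3_of_isMinorMinimal, fun h => h.isMinorMinimal⟩,
    ⟨fun h => ⟨h.card_eq, h.isEdgeMinimal⟩, fun h => h.2.inO3 h.1⟩,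
    fun _ _ => MMWidth.eq_of_obstruction_iso⟩
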